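/- **Setting.** A network is a finite directed graph (loops and parallel arcs allowed) whose arcs are coloured with $\lambda$ colours. For each colour $i\in\{1,\dots,\lambda\}$ let $R_{i1},\dots,R_{iq_i}$ be networks, each with two distinct distinguished nodes $A$ and $B$, and let $p_{i1},\dots,p_{iq_i}>0$ with $\sum_{k=1}^{q_i}p_{ik}=1$. Given an initial network $G^0$ with at least one arc, form $G^{t+1}$ from $G^t$ by replacing all arcs simultaneously: each arc $e$ of colour $i$ is, independently of all other choices, replaced by a fresh copy of $R_{ik}$ with probability $p_{ik}$, where the node $A$ of the copy is identified with the beginning node of $e$ and $B$ with the ending node of $e$; all nodes of $G^t$ are kept. Let $\Gamma=(G^0,G^1,G^2,\dots)$ be the resulting random sequence, and let $V(G^t)$ be the node set of $G^t$. Let $\mathbf M$ be the $\lambda\times\lambda$ matrix whose $(i,j)$ entry is $\sum_{k=1}^{q_i}p_{ik}\,\chi_j(R_{ik})$, where $\chi_j(R)$ is the number of $j$-coloured arcs of $R$, and let $\rho(\mathbf M)$ be its spectral radius. **Assumptions.** (a) $\mathbf M$ is primitive, i.e. it is non-negative and some power $\mathbf M^m$, $m\ge 1$, has all entries positive. (b)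 For each colour $i$ there is a $k$ such that the distance between $A$ and $B$ in the underlying undirected graph of $R_{ik}$ is greater than $1$ (it is $\infty$ if no path joins them). (c) For each colour $i$ there is a $k$ such that in $R_{ik}$ the sum of the in-degree and the out-degree of at least one of the nodes $A$ and $B$ is greater than $1$. (d) Each $R_{ik}$ has an arc joining two different nodes. **Theorem.** For almost every realisation $\Gamma$, $|V(G^t)|\asymp\rho(\mathbf M)^t$ as $t\to\infty$; that is, almost surely there is a (realisation-dependent) constant $c=c(\Gamma)\in(0,\infty)$ such that \[ \lim_{t\to\infty}\frac{|V(G^t)|}{\rho(\mathbf M)^t}=c . \] -/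

import Mathlib

open MeasureTheory ProbabilityTheory Filter
open scoped Topology

noncomputable section

/-- A finite directed network (parallel arcs and loops allowed) with arcs coloured by `C`. -/
structure Network (C : Type) where
  /-- the nodes -/
  V : Type
  /-- the arcs -/
  E : Type
  finV : Finite V
  finE : Finite E
  /-- beginning node of an arc -/
  src : E → V
  /-- ending node of an arc -/
  tgt : E → V
  /-- colour of an arc -/
  color : E → C

attribute [instance] Network.finV Network.finE

namespace Network

variable {C : Type}

/-- The number of `j`-coloured arcs of `G`. -/
def arcCount (G : Network C) (j : C) : ℕ := Nat.card {e : G.E // G.color e = j}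

/-- The out-degree of a node. -/
def outDeg (G : Network C) (v : G.V) : ℕ := Nat.card {e : G.E // G.src e = v}

/-- The in-degree of a node. -/
def inDeg (G : Network C) (v : G.V) : ℕ := Nat.card {e : G.E // G.tgt e = v}

/-- The underlying simple undirected graph: distinct nodes are adjacent if and only if
some arc joins them, in either direction. -/
def underlying (G : Network C) : SimpleGraph G.V :=
  SimpleGraph.fromRel fun u v => ∃ e : G.E, G.src e = u ∧ G.tgt e = v

end Network

/-- A network with two distinguished distinct nodes `A` and `B`, as used to replace an arc. -/
structure RuleNetwork (C : Type) extends Network C where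
  A : V
  B : V
  A_ne_B : A ≠ B

namespace RuleNetwork

variable {C : Type}

/-- The nodes of a rule network other than `A` and `B`. -/
abbrev Inner (R : RuleNetwork C) : Type := {v : R.V // v ≠ R.A ∧ v ≠ R.B}

end RuleNetwork

open Classical in
/-- The network obtained from `G` by replacing every arc `e` by a fresh copy of the rule network
`R e`, whose node `A` is identified with the beginning node of `e` and whose node `B` is
identified with the ending node of `e`. The nodes of `G` are kept. -/
def Network.replaceArcs {C : Type} (G : Network C) (R : G.E → RuleNetwork C) : Network C where
  V := G.V ⊕ (Σ e : G.E, (R e).Inner)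
  E := Σ e : G.E, (R e).E
  finV := inferInstance
  finE := inferInstance
  src a :=
    if hA : (R a.1).src a.2 = (R a.1).A then Sum.inl (G.src a.1)
    else if hB : (R a.1).src a.2 = (R a.1).B then Sum.inl (G.tgt a.1)
    else Sum.inr ⟨a.1, (R a.1).src a.2, hA, hB⟩
  tgt a :=
    if hA : (R a.1).tgt a.2 = (R a.1).A then Sum.inl (G.src a.1)
    else if hB : (R a.1).tgt a.2 = (R a.1).B then Sum.inl (G.tgt a.1)
    else Sum.inr ⟨a.1, (R a.1).tgt a.2, hA, hB⟩
  color a := (R a.1).color a.2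

/-- The replacement rules of a random coloured substitution network with `lam` colours: an arc of
colour `i` is replaced by `R i k` with probability `p i k`, where `k` runs through `q i` values. -/
structure SubstitutionRules (lam : ℕ) where
  q : Fin lam → ℕ
  R : ∀ i, Fin (q i) → RuleNetwork (Fin lam)
  p : ∀ i, Fin (q i) → ℝ
  p_pos : ∀ i k, 0 < p i k
  p_sum : ∀ i, ∑ k, p i k = 1

namespace SubstitutionRules

variable {lam : ℕ}

/-- The matrix `M`: its `(i, j)` entry is the expected number of `j`-coloured arcs in the random
network that replaces an `i`-coloured arc. -/
def arcMatrix (S : SubstitutionRules lam) : Matrix (Fin lam) (Fin lam) ℝ :=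
  Matrix.of fun i j => ∑ k, S.p i k * ((S.R i k).arcCount j : ℝ)

/-- The sequence `G^0, G^1, G^2, …` produced by prescribed choices. In every network the arcs are
numbered `0, 1, 2, …` in some fixed way; `x (t, n, i)` is the index of the rule network that
replaces the `n`-th arc of `G^t` if that arc has colour `i`. -/
def networkSeq (S : SubstitutionRules lam) (G₀ : Network (Fin lam))
    (x : ∀ a : ℕ × ℕ × Fin lam, Fin (S.q a.2.2)) : ℕ → Network (Fin lam)
  | 0 => G₀
  | t + 1 => (S.networkSeq G₀ x t).replaceArcs fun e =>
      S.R ((S.networkSeq G₀ x t).color e)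
        (x (t, (Finite.equivFin (S.networkSeq G₀ x t).E e : ℕ), (S.networkSeq G₀ x t).color e))

/-- `X` is a family of independent random choices following the probabilities of `S`. -/
structure IsChoiceFamily (S : SubstitutionRules lam) {Ω : Type*} [MeasurableSpace Ω]
    (P : Measure Ω) (X : ∀ a : ℕ × ℕ × Fin lam, Ω → Fin (S.q a.2.2)) : Prop where
  measurable : ∀ a, Measurable (X a)
  indep : iIndepFun X P
  law : ∀ (a : ℕ × ℕ × Fin lam) (k : Fin (S.q a.2.2)),
    P {ω | X a ω = k} = ENNReal.ofReal (S.p a.2.2 k)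

end SubstitutionRules

/-- The spectral radius of a real square matrix: the largest modulus of its complex eigenvalues. -/
def realSpectralRadius {n : ℕ} (M : Matrix (Fin n) (Fin n) ℝ) : ℝ :=
  (spectralRadius ℂ (M.map (algebraMap ℝ ℂ))).toReal

/-- `f(t) ≍ g(t)` as `t → ∞`: the quotient `f(t) / g(t)` tends to a positive real constant. -/
def AsympProp (f g : ℕ → ℝ) : Prop :=
  ∃ c : ℝ, 0 < c ∧ Tendsto (fun t => f t / g t) atTop (𝓝 c)

end

noncomputable section

/-! The arc counts by colour, `Z t`, form a multitype Galton–Watson process with mean matrix `M`: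
given `Z t`, the mean of `Z (t + 1)` is `Z t ᵥ* M`. Each round adds exactly the inner nodes of the
chosen rules. Let `r` be the Perron root, with right and left eigenvectors `h` and `v`. Every arc
leaves at least one arc and, by (c) and (d), more than one with positive probability, so `r > 1`.

The deviation of one round from its conditional mean has second moment `O(r ^ t)`, so divided by `r
^ t` it is almost surely summable (`ae_summable_choiceSum_sub_mean`). From there the argument is
deterministic (`tendsto_div_pow_of_recursion`): `Z t ⬝ᵥ h / r ^ t` converges to some `W`,
primitivity removes all directions except `v`, and the node count divided by `r ^ t` tends to `W *
(v ⬝ᵥ m) / (r - 1)`, where `m` is the mean number of inner nodes. By (b) and (d), `m` is positive.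

It remains to see that `W > 0` almost surely (`ae_not_tendsto_zero`). Laplace transforms at time `s
+ n`, at argument of order `r ^ (-n)`, are bounded by one at time `s`, uniformly in `n`. Fatou's
lemma then bounds `P(W = 0)` by the latter, which vanishes as `s → ∞` because the number of arcs
grows. -/

theorem exists_pos_mul_le {n : Type*} [Finite n] {x y : n → ℝ} (hx : ∀ i, 0 < x i) :
    ∃ ε > 0, ∀ i, ε * y i ≤ x i := by
  have : Fintype n := Fintype.ofFinite n
  have h : ∀ i, ∃ ε > 0, ∀ δ, 0 < δ → δ ≤ ε → δ * y i ≤ x i := by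
    intro i
    refine ⟨x i / (|y i| + 1), by have := hx i; positivity, fun δ h0 hδ => ?_⟩
    rw [le_div_iff₀ (by positivity)] at hδ
    nlinarith [le_abs_self (y i)]
  choose ε h0 h using h
  rcases isEmpty_or_nonempty n with hn | hn
  · exact ⟨1, one_pos, fun i => hn.elim i⟩
  obtain ⟨i₀, hi₀⟩ := Finite.exists_min ε
  exact ⟨ε i₀, h0 i₀, fun i => h i _ (h0 i₀) (hi₀ i)⟩

/-! ### Perron–Frobenius theory of primitive matrices -/

namespace Matrix

variable {n : Type*} [Fintype n]

theorem mulVec_pos_of_pos {A : Matrix n n ℝ} (hA : ∀ i j, 0 < A i j) {x : n → ℝ}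
    (hx : 0 ≤ x) (hx0 : x ≠ 0) (i : n) : 0 < (A *ᵥ x) i := by
  obtain ⟨j, hj⟩ := Function.ne_iff.1 hx0
  exact Finset.sum_pos' (fun k _ => mul_nonneg (hA i k).le (hx k))
    ⟨j, Finset.mem_univ j, mul_pos (hA i j) (lt_of_le_of_ne (hx j) (Ne.symm hj))⟩

theorem mulVec_nonneg_of_nonneg {A : Matrix n n ℝ} (hA : ∀ i j, 0 ≤ A i j) {x : n → ℝ}
    (hx : 0 ≤ x) : 0 ≤ A *ᵥ x :=
  fun i => Finset.sum_nonneg fun k _ => mul_nonneg (hA i k) (hx k)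

theorem pow_mulVec_of_mulVec_eq_smul [DecidableEq n] {A : Matrix n n ℝ} {x : n → ℝ} {r : ℝ}
    (h : A *ᵥ x = r • x) (m : ℕ) : A ^ m *ᵥ x = r ^ m • x := by
  induction m with
  | zero => simp
  | succ m ih => rw [pow_succ, ← mulVec_mulVec, h, mulVec_smul, ih, smul_smul, pow_succ']

/-- A primitive matrix has a positive eigenvector with positive eigenvalue
(the Collatz–Wielandt maximum is attained there). -/
theorem IsPrimitive.exists_pos_eigenvector [DecidableEq n] [Nonempty n] {M : Matrix n n ℝ}
    (hM : M.IsPrimitive) :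
    ∃ r : ℝ, 0 < r ∧ ∃ h : n → ℝ, (∀ i, 0 < h i) ∧ M *ᵥ h = r • h := by
  obtain ⟨hnn, m, hm, hpos⟩ := hM
  set B : ℝ := ∑ i, ∑ j, M i j with hB
  have hB0 : 0 ≤ B := Finset.sum_nonneg fun i _ => Finset.sum_nonneg fun j _ => hnn i j
  -- Normalising to the simplex makes this set compact. The bound `B` loses nothing: summing the
  -- coordinates of `s • y ≤ M *ᵥ y` over a simplex vector gives `s ≤ B`.
  let T : Set (ℝ × (n → ℝ)) := (Set.Icc 0 B ×ˢ stdSimplex ℝ n) ∩ {p | p.1 • p.2 ≤ M *ᵥ p.2}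
  have hTc : IsCompact T := by
    refine (isCompact_Icc.prod (isCompact_stdSimplex ℝ n)).inter_right ?_
    refine isClosed_le (by fun_prop) ?_
    exact (Continuous.matrix_mulVec continuous_const continuous_snd)
  have hTn : T.Nonempty := by
    classical
    refine ⟨(0, Pi.single (Classical.arbitrary n) 1),
      ⟨⟨⟨le_rfl, hB0⟩, single_mem_stdSimplex ℝ _⟩, ?_⟩⟩
    simp only [Set.mem_ofPred_eq, zero_smul]
    exact mulVec_nonneg_of_nonneg hnn (single_mem_stdSimplex ℝ _).1
  obtain ⟨⟨r, x⟩, ⟨⟨⟨hr0, hrB⟩, hx⟩, hrx⟩, hmax⟩ :=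
    hTc.exists_isMaxOn hTn continuous_fst.continuousOn
  simp only at hr0 hrB hx
  simp only [Set.mem_ofPred_eq] at hrx
  have hmax' : ∀ (s : ℝ) (y : n → ℝ), 0 ≤ s → (∀ i, 0 < y i) → s • y ≤ M *ᵥ y → s ≤ r := by
    intro s y hs hy hsy
    set c := ∑ i, y i with hc
    have hc0 : 0 < c := Finset.sum_pos (fun i _ => hy i) Finset.univ_nonempty
    have hyS : c⁻¹ • y ∈ stdSimplex ℝ n := by
      refine ⟨fun i => mul_nonneg (inv_nonneg.2 hc0.le) (hy i).le, ?_⟩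
      simp only [Pi.smul_apply, smul_eq_mul, ← Finset.mul_sum]
      exact inv_mul_cancel₀ hc0.ne'
    have hsy' : s • c⁻¹ • y ≤ M *ᵥ (c⁻¹ • y) := by
      rw [mulVec_smul, smul_comm]
      exact smul_le_smul_of_nonneg_left hsy (inv_nonneg.2 hc0.le)
    have hsB : s ≤ B := by
      have h1 : ∑ i, (s • c⁻¹ • y) i ≤ ∑ i, (M *ᵥ (c⁻¹ • y)) i :=
        Finset.sum_le_sum fun i _ => hsy' i
      have h2 : ∑ i, (s • c⁻¹ • y) i = s := by
        simp only [Pi.smul_apply s, smul_eq_mul, ← Finset.mul_sum]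
        rw [hyS.2, mul_one]
      rw [h2] at h1
      refine h1.trans (Finset.sum_le_sum fun i _ => Finset.sum_le_sum fun j _ => ?_)
      exact mul_le_of_le_one_right (hnn i j) (le_of_le_of_eq
        (Finset.single_le_sum (f := c⁻¹ • y) (fun k _ => hyS.1 k) (Finset.mem_univ j)) hyS.2)
    exact hmax (show (s, c⁻¹ • y) ∈ T from ⟨⟨⟨hs, hsB⟩, hyS⟩, hsy'⟩)
  have hx0 : x ≠ 0 := by
    rintro rfl
    simpa using hx.2
  have hy := mulVec_pos_of_pos hpos hx.1 hx0
  have heig : M *ᵥ x = r • x := by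
    by_contra hne
    have hz := mulVec_pos_of_pos hpos (sub_nonneg.2 hrx) (sub_ne_zero.2 hne)
    obtain ⟨ε, hε, hle⟩ := exists_pos_mul_le (y := M ^ m *ᵥ x) hz
    have := hmax' (r + ε) (M ^ m *ᵥ x) (by positivity) hy (by
      intro i
      have h1 := hle i
      rw [mulVec_sub, mulVec_mulVec, ← pow_succ, pow_succ', ← mulVec_mulVec, mulVec_smul] at h1
      simp only [Pi.sub_apply, Pi.smul_apply, smul_eq_mul] at h1 ⊢
      linarith)
    linarith
  have hpow := pow_mulVec_of_mulVec_eq_smul heig m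
  have hxr : ∀ i, 0 < r ^ m * x i := fun i => by
    have := hy i
    rw [hpow] at this
    exact this
  have hxp : ∀ i, 0 < x i := fun i =>
    (hx.1 i).lt_of_ne fun h => by have := hxr i; rw [← h] at this; simp at this
  refine ⟨r, hr0.lt_of_ne fun h => ?_, x, hxp, heig⟩
  have := hxr (Classical.arbitrary n)
  rw [← h, zero_pow hm.ne'] at this
  simp at this

theorem IsPrimitive.transpose [DecidableEq n] {M : Matrix n n ℝ} (hM : M.IsPrimitive) :
    Mᵀ.IsPrimitive := by
  obtain ⟨hnn, m, hm, hpos⟩ := hM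
  exact ⟨fun i j => hnn j i, m, hm, fun i j => by rw [← transpose_pow]; exact hpos j i⟩

theorem IsPrimitive.smul [DecidableEq n] {M : Matrix n n ℝ} (hM : M.IsPrimitive) {c : ℝ}
    (hc : 0 < c) : (c • M).IsPrimitive := by
  obtain ⟨hnn, m, hm, hpos⟩ := hM
  exact ⟨fun i j => mul_nonneg hc.le (hnn i j), m, hm, fun i j => by
    rw [smul_pow]; exact mul_pos (pow_pos hc m) (hpos i j)⟩

/-- Left and right Perron vectors for the same eigenvalue. -/
theorem IsPrimitive.exists_left_right_eigenvector [DecidableEq n] [Nonempty n]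
    {M : Matrix n n ℝ} (hM : M.IsPrimitive) :
    ∃ r : ℝ, 0 < r ∧ ∃ h v : n → ℝ, (∀ i, 0 < h i) ∧ (∀ i, 0 < v i) ∧ M *ᵥ h = r • h ∧
      v ᵥ* M = r • v ∧ v ⬝ᵥ h = 1 := by
  obtain ⟨r, hr, h, hh, hMh⟩ := hM.exists_pos_eigenvector
  obtain ⟨s, hs, v, hv, hMv⟩ := hM.transpose.exists_pos_eigenvector
  rw [mulVec_transpose] at hMv
  have hvh : 0 < v ⬝ᵥ h := Finset.sum_pos (fun i _ => mul_pos (hv i) (hh i)) Finset.univ_nonempty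
  have hsr : s = r := by
    have h1 := dotProduct_mulVec v M h
    rw [hMh, hMv, dotProduct_smul, smul_dotProduct, smul_eq_mul, smul_eq_mul] at h1
    exact (mul_right_cancel₀ hvh.ne' h1).symm
  subst hsr
  refine ⟨s, hs, h, (v ⬝ᵥ h)⁻¹ • v, hh, fun i => mul_pos (inv_pos.2 hvh) (hv i), hMh, ?_, ?_⟩
  · rw [smul_vecMul, hMv, smul_comm]
  · rw [smul_dotProduct, smul_eq_mul, inv_mul_cancel₀ hvh.ne']

/-- The powers of a primitive matrix with Perron eigenvalue `1` contract to zero on the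
kernel of the left Perron vector. -/
theorem IsPrimitive.tendsto_pow_mulVec_zero [DecidableEq n] {A : Matrix n n ℝ}
    (hA : A.IsPrimitive) {h v : n → ℝ} (hh : ∀ i, 0 < h i) (hAh : A *ᵥ h = h)
    (hvA : v ᵥ* A = v) (hvh : v ⬝ᵥ h = 1) {w : n → ℝ} (hw : v ⬝ᵥ w = 0) :
    Tendsto (fun k => A ^ k *ᵥ w) atTop (𝓝 0) := by
  obtain ⟨hnn, m, hm, hpos⟩ := hA
  have hvpow : ∀ k, v ᵥ* A ^ k = v := fun k => by
    induction k with
    | zero => simp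
    | succ k ih => rw [pow_succ, ← vecMul_vecMul, ih, hvA]
  have hhpow : ∀ k, A ^ k *ᵥ h = h := fun k => by
    simpa using pow_mulVec_of_mulVec_eq_smul (r := 1) (by simpa using hAh) k
  -- Doeblin minorisation: `A ^ m` dominates `ε` times the rank-one matrix `h i * v j`. That matrix
  -- annihilates the kernel of `v`, so removing it costs nothing there and shrinks the `h`-weighted
  -- sup norm by `1 - ε`. The absolute value is needed since `v` carries no sign assumption.
  obtain ⟨ε₀, hε₀, hle₀⟩ := exists_pos_mul_le (n := n × n) (x := fun p => (A ^ m) p.1 p.2)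
    (y := fun p => |h p.1 * v p.2|) (fun p => hpos p.1 p.2)
  set ε := min ε₀ (1 / 2) with hεdef
  have hε : 0 < ε := lt_min hε₀ (by norm_num)
  have hε1 : ε ≤ 1 / 2 := min_le_right _ _
  have hle : ∀ i j, ε * (h i * v j) ≤ (A ^ m) i j := fun i j =>
    calc ε * (h i * v j) ≤ ε * |h i * v j| := by gcongr; exact le_abs_self _
      _ ≤ ε₀ * |h i * v j| := by gcongr; exact min_le_left _ _
      _ ≤ (A ^ m) i j := hle₀ (i, j)
  have step : ∀ (x : n → ℝ) (c : ℝ), (∀ i, |x i| ≤ c * h i) → ∀ i, |(A *ᵥ x) i| ≤ c * h i := by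
    intro x c hx i
    calc |(A *ᵥ x) i| ≤ ∑ j, |A i j * x j| := Finset.abs_sum_le_sum_abs _ _
      _ ≤ ∑ j, A i j * (c * h j) := Finset.sum_le_sum fun j _ => by
          rw [abs_mul, abs_of_nonneg (hnn i j)]
          exact mul_le_mul_of_nonneg_left (hx j) (hnn i j)
      _ = c * (A *ᵥ h) i := by
          simp only [mulVec, dotProduct, Finset.mul_sum]
          exact Finset.sum_congr rfl fun j _ => by ring
      _ = c * h i := by rw [hAh]
  have contract : ∀ (x : n → ℝ) (c : ℝ), v ⬝ᵥ x = 0 → (∀ i, |x i| ≤ c * h i) →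
      ∀ i, |(A ^ m *ᵥ x) i| ≤ (1 - ε) * c * h i := by
    intro x c hvx hx i
    have h1 : (A ^ m *ᵥ x) i = ∑ j, ((A ^ m) i j - ε * (h i * v j)) * x j := by
      simp only [sub_mul, Finset.sum_sub_distrib]
      have : ∑ j, ε * (h i * v j) * x j = ε * h i * (v ⬝ᵥ x) := by
        simp only [dotProduct, Finset.mul_sum]
        exact Finset.sum_congr rfl fun j _ => by ring
      rw [this, hvx]
      simp [mulVec, dotProduct]
    rw [h1]
    calc _ ≤ ∑ j, |((A ^ m) i j - ε * (h i * v j)) * x j| := Finset.abs_sum_le_sum_abs _ _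
      _ ≤ ∑ j, ((A ^ m) i j - ε * (h i * v j)) * (c * h j) := Finset.sum_le_sum fun j _ => by
          rw [abs_mul, abs_of_nonneg (sub_nonneg.2 (hle i j))]
          exact mul_le_mul_of_nonneg_left (hx j) (sub_nonneg.2 (hle i j))
      _ = c * (A ^ m *ᵥ h) i - c * ε * h i * (v ⬝ᵥ h) := by
          simp only [mulVec, dotProduct, Finset.mul_sum, ← Finset.sum_sub_distrib]
          exact Finset.sum_congr rfl fun j _ => by ring
      _ = (1 - ε) * c * h i := by rw [hhpow, hvh]; ring
  obtain ⟨c, hc0, hc⟩ : ∃ c : ℝ, 0 < c ∧ ∀ i, |w i| ≤ c * h i := by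
    obtain ⟨δ, hδ, hle⟩ := exists_pos_mul_le (y := fun i => |w i|) hh
    refine ⟨δ⁻¹, inv_pos.2 hδ, fun i => ?_⟩
    rw [inv_mul_eq_div, le_div_iff₀ hδ, mul_comm]
    exact hle i
  have iter : ∀ k i, |(A ^ (m * k) *ᵥ w) i| ≤ (1 - ε) ^ k * c * h i := by
    intro k
    induction k with
    | zero => simpa using hc
    | succ k ih =>
      rw [mul_add, mul_one, add_comm, pow_add, ← mulVec_mulVec, pow_succ', mul_assoc (1 - ε)]
      refine contract _ _ ?_ ih
      rw [dotProduct_mulVec, hvpow, hw]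
  have iter' : ∀ k l i, |(A ^ (l + m * k) *ᵥ w) i| ≤ (1 - ε) ^ k * c * h i := by
    intro k l
    induction l with
    | zero => simpa using iter k
    | succ l ih =>
      rw [add_right_comm, pow_succ', ← mulVec_mulVec]
      exact step _ _ ih
  rw [tendsto_pi_nhds]
  intro i
  refine squeeze_zero_norm (a := fun k => (1 - ε) ^ (k / m) * c * h i) (fun k => ?_) ?_
  · have := iter' (k / m) (k % m) i
    rwa [Nat.mod_add_div] at this
  · have h1 : Tendsto (fun k : ℕ => (1 - ε) ^ k) atTop (𝓝 0) :=
      tendsto_pow_atTop_nhds_zero_of_lt_one (by linarith) (by linarith)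
    have h2 := ((h1.comp (Nat.tendsto_div_const_atTop hm.ne')).mul_const c).mul_const (h i)
    simpa using h2

end Matrix

/-- An eigenvalue with a positive eigenvector of a non-negative matrix is its spectral radius. -/
theorem realSpectralRadius_eq_of_pos_eigenvector {n : ℕ} [NeZero n] {M : Matrix (Fin n) (Fin n) ℝ}
    (hM : ∀ i j, 0 ≤ M i j) {h : Fin n → ℝ} (hh : ∀ i, 0 < h i) {r : ℝ} (hr : 0 ≤ r)
    (hMh : M.mulVec h = r • h) : realSpectralRadius M = r := by
  have key : ∀ μ : ℂ, μ ∈ spectrum ℂ (M.map (algebraMap ℝ ℂ)) ↔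
      Module.End.HasEigenvalue (Matrix.toLin' (M.map (algebraMap ℝ ℂ))) μ := fun μ => by
    rw [Module.End.hasEigenvalue_iff_mem_spectrum, Matrix.spectrum_toLin']
  have hmem : (r : ℂ) ∈ spectrum ℂ (M.map (algebraMap ℝ ℂ)) := by
    rw [key]
    refine Module.End.hasEigenvalue_of_hasEigenvector (x := fun i => (h i : ℂ)) ⟨?_, ?_⟩
    · rw [Module.End.mem_eigenspace_iff, Matrix.toLin'_apply]
      ext i
      have := congrArg (fun x : ℝ => (x : ℂ)) (congrFun hMh i)
      simpa [Matrix.mulVec, dotProduct] using this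
    · intro h0
      have := congrFun h0 0
      have h1 := hh 0
      simp at this
      exact h1.ne' this
  have hle : ∀ μ ∈ spectrum ℂ (M.map (algebraMap ℝ ℂ)), ‖μ‖ ≤ r := by
    intro μ hμ
    obtain ⟨x, hx⟩ := ((key μ).1 hμ).exists_hasEigenvector
    have hx0 := hx.2
    have hxe := hx.apply_eq_smul
    rw [Matrix.toLin'_apply] at hxe
    -- The coordinate where the `h`-weighted sup norm of the eigenvector is attained; the eigenvalue
    -- equation there gives `‖μ‖ ≤ r`.
    obtain ⟨i₀, hi₀⟩ := Finite.exists_max fun i => ‖x i‖ / h i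
    set c := ‖x i₀‖ / h i₀ with hc
    have hcx : ∀ i, ‖x i‖ ≤ c * h i := fun i => (div_le_iff₀ (hh i)).1 (hi₀ i)
    have hc0 : 0 < c := by
      obtain ⟨j, hj⟩ := Function.ne_iff.1 hx0
      exact lt_of_lt_of_le (div_pos (norm_pos_iff.2 hj) (hh j)) (hi₀ j)
    have hxi : ‖x i₀‖ = c * h i₀ := by rw [hc, div_mul_cancel₀ _ (hh i₀).ne']
    have h1 : ‖μ‖ * ‖x i₀‖ ≤ r * (c * h i₀) := by
      have h2 : μ * x i₀ = ∑ j, (M i₀ j : ℂ) * x j := by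
        have := congrFun hxe i₀
        simpa [Matrix.mulVec, dotProduct] using this.symm
      rw [← norm_mul, h2]
      calc _ ≤ ∑ j, ‖(M i₀ j : ℂ) * x j‖ := norm_sum_le _ _
        _ ≤ ∑ j, M i₀ j * (c * h j) := Finset.sum_le_sum fun j _ => by
            rw [norm_mul, Complex.norm_real, Real.norm_of_nonneg (hM i₀ j)]
            exact mul_le_mul_of_nonneg_left (hcx j) (hM i₀ j)
        _ = c * (M.mulVec h) i₀ := by
            simp only [Matrix.mulVec, dotProduct, Finset.mul_sum]
            exact Finset.sum_congr rfl fun j _ => by ring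
        _ = r * (c * h i₀) := by rw [hMh]; simp only [Pi.smul_apply, smul_eq_mul]; ring
    rw [hxi] at h1
    exact le_of_mul_le_mul_right h1 (mul_pos hc0 (hh i₀))
  have : spectralRadius ℂ (M.map (algebraMap ℝ ℂ)) = ENNReal.ofReal r := by
    apply le_antisymm
    · refine iSup₂_le fun μ hμ => ?_
      rw [← enorm_eq_nnnorm, ← ofReal_norm]
      exact ENNReal.ofReal_le_ofReal (hle μ hμ)
    · refine le_trans (le_of_eq ?_) (le_iSup₂
        (f := fun (k : ℂ) (_ : k ∈ spectrum ℂ _) => (‖k‖₊ : ENNReal)) (r : ℂ) hmem)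
      rw [← enorm_eq_nnnorm, ← ofReal_norm, Complex.norm_real, Real.norm_of_nonneg hr]
  rw [realSpectralRadius, this, ENNReal.toReal_ofReal hr]

/-! ### Linear recursions with summable noise -/

/-- The convolution of a summable sequence with a null sequence is a null sequence. -/
theorem tendsto_sum_range_mul_zero {a b : ℕ → ℝ} (ha : Summable fun s => |a s|)
    (hb : Tendsto b atTop (𝓝 0)) :
    Tendsto (fun t => ∑ s ∈ Finset.range t, a s * b (t - 1 - s)) atTop (𝓝 0) := by
  obtain ⟨C, hC⟩ := hb.norm.bddAbove_range
  have hC' : ∀ k, |b k| ≤ C := fun k => hC ⟨k, rfl⟩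
  -- Extension by zero turns the growing sum into a series, to which dominated convergence applies.
  let F : ℕ → ℕ → ℝ := fun t s => if s < t then a s * b (t - 1 - s) else 0
  have hF : ∀ t, ∑ s ∈ Finset.range t, a s * b (t - 1 - s) = ∑' s, F t s := by
    intro t
    rw [tsum_eq_sum (s := Finset.range t) fun s hs => if_neg (by simpa using hs)]
    exact Finset.sum_congr rfl fun s hs => (if_pos (Finset.mem_range.1 hs)).symm
  simp_rw [hF]
  have := tendsto_tsum_of_dominated_convergence (𝓕 := atTop) (f := F) (g := fun _ => (0 : ℝ))
    (bound := fun s => |a s| * C) (ha.mul_right C) ?_ ?_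
  · simpa using this
  · intro s
    have h1 : Tendsto (fun t => a s * b (t - 1 - s)) atTop (𝓝 0) := by
      have : Tendsto (fun t : ℕ => t - 1 - s) atTop atTop :=
        (tendsto_sub_atTop_nat s).comp (tendsto_sub_atTop_nat 1)
      simpa using (hb.comp this).const_mul (a s)
    refine h1.congr' ?_
    filter_upwards [eventually_gt_atTop s] with t ht
    exact (if_pos ht).symm
  · refine Eventually.of_forall fun t s => ?_
    have hC0 : 0 ≤ C := (abs_nonneg _).trans (hC' 0)
    by_cases hs : s < t
    · simp only [F, if_pos hs, Real.norm_eq_abs, abs_mul]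
      exact mul_le_mul_of_nonneg_left (hC' _) (abs_nonneg _)
    · simp only [F, if_neg hs, norm_zero]
      positivity

/-- Measured from the fixed point of `l = q * l + c`, the solution is a geometric term plus the
convolution of `q ^ s` with the null sequence `e - c`. -/
theorem tendsto_of_linear_recursion {q c : ℝ} (hq0 : 0 ≤ q) (hq1 : q < 1) {b e : ℕ → ℝ}
    (he : Tendsto e atTop (𝓝 c)) (hb : ∀ t, b (t + 1) = q * b t + e t) :
    Tendsto b atTop (𝓝 (c / (1 - q))) := by
  have h1q : (1 - q) ≠ 0 := by linarith
  set l := c / (1 - q) with hl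
  have hl' : l = q * l + c := by rw [hl]; field_simp; ring
  have hform : ∀ t, b t = l + q ^ t * (b 0 - l) +
      ∑ s ∈ Finset.range t, q ^ s * (e (t - 1 - s) - c) := by
    intro t
    induction t with
    | zero => simp
    | succ t ih =>
      rw [hb, ih, Finset.sum_range_succ']
      have : ∑ k ∈ Finset.range t, q ^ (k + 1) * (e (t + 1 - 1 - (k + 1)) - c) =
          q * ∑ k ∈ Finset.range t, q ^ k * (e (t - 1 - k) - c) := by
        rw [Finset.mul_sum]
        refine Finset.sum_congr rfl fun k _ => ?_
        rw [show t + 1 - 1 - (k + 1) = t - 1 - k by omega]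
        ring
      rw [this]
      simp only [Nat.add_sub_cancel, Nat.sub_zero]
      linear_combination -hl'
  have h1 : Tendsto (fun t => q ^ t * (b 0 - l)) atTop (𝓝 0) := by
    simpa using (tendsto_pow_atTop_nhds_zero_of_lt_one hq0 hq1).mul_const (b 0 - l)
  have h2 := tendsto_sum_range_mul_zero (a := fun s => q ^ s) (b := fun k => e k - c)
    (by simpa [abs_of_nonneg (pow_nonneg hq0 _)] using summable_geometric_of_lt_one hq0 hq1)
    (by simpa using he.sub_const c)
  rw [show b = fun t => _ from funext hform]
  simpa using (tendsto_const_nhds.add h1).add h2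

open Matrix in
-- Unrolling the recursion, the noise of time `s` is paired at time `t` with `A ^ (t - 1 - s) *ᵥ w`:
-- a convolution of summable and null sequences.
theorem tendsto_dotProduct_zero_of_recursion {n : Type*} [Fintype n] [DecidableEq n]
    {A : Matrix n n ℝ} {U ξ : ℕ → n → ℝ} (hU : ∀ t, U (t + 1) = U t ᵥ* A + ξ t)
    (hξ : ∀ j, Summable fun t => |ξ t j|) {w : n → ℝ}
    (hw : Tendsto (fun k => A ^ k *ᵥ w) atTop (𝓝 0)) :
    Tendsto (fun t => U t ⬝ᵥ w) atTop (𝓝 0) := by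
  have hform : ∀ (t : ℕ) (w : n → ℝ), U t ⬝ᵥ w = U 0 ⬝ᵥ (A ^ t *ᵥ w) +
      ∑ s ∈ Finset.range t, ξ s ⬝ᵥ (A ^ (t - 1 - s) *ᵥ w) := by
    intro t
    induction t with
    | zero => simp
    | succ t ih =>
      intro w
      rw [hU, add_dotProduct, ← dotProduct_mulVec, ih, mulVec_mulVec, ← pow_succ,
        Finset.sum_range_succ, Nat.add_sub_cancel, Nat.sub_self, pow_zero, one_mulVec, add_assoc]
      congr 2
      refine Finset.sum_congr rfl fun s hs => ?_
      rw [mulVec_mulVec, ← pow_succ]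
      congr 3
      have := Finset.mem_range.1 hs
      omega
  have hw' := tendsto_pi_nhds.1 hw
  have h1 : Tendsto (fun t => U 0 ⬝ᵥ (A ^ t *ᵥ w)) atTop (𝓝 0) := by
    have := tendsto_finsetSum Finset.univ fun j _ => (hw' j).const_mul (U 0 j)
    simpa [dotProduct] using this
  have h2 := tendsto_finsetSum Finset.univ fun j _ => tendsto_sum_range_mul_zero (hξ j) (hw' j)
  simp_rw [fun t => hform t w]
  have h3 : ∀ t, ∑ s ∈ Finset.range t, ξ s ⬝ᵥ (A ^ (t - 1 - s) *ᵥ w) =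
      ∑ j, ∑ s ∈ Finset.range t, ξ s j * (A ^ (t - 1 - s) *ᵥ w) j := fun t => by
    rw [Finset.sum_comm]; rfl
  simp_rw [h3]
  simpa using h1.add h2

open Matrix in
/-- A perturbed linear recursion with primitive matrix grows in the direction of the left Perron
vector, and so does the sequence of its partial sums. -/
theorem tendsto_div_pow_of_recursion {n : Type*} [Fintype n] [DecidableEq n] {M : Matrix n n ℝ}
    (hM : M.IsPrimitive) {r : ℝ} (hr : 1 < r) {h v : n → ℝ} (hh : ∀ i, 0 < h i)
    (hMh : M *ᵥ h = r • h) (hvM : v ᵥ* M = r • v) (hvh : v ⬝ᵥ h = 1)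
    {Z η : ℕ → n → ℝ} (hZ : ∀ t, Z (t + 1) = Z t ᵥ* M + η t)
    (hη : ∀ j, Summable fun t => |η t j| / r ^ t) {m : n → ℝ} {V η' : ℕ → ℝ}
    (hV : ∀ t, V (t + 1) = V t + Z t ⬝ᵥ m + η' t)
    (hη' : Tendsto (fun t => η' t / r ^ t) atTop (𝓝 0)) :
    ∃ W : ℝ, Tendsto (fun t => Z t ⬝ᵥ h / r ^ t) atTop (𝓝 W) ∧
      Tendsto (fun t => V t / r ^ t) atTop (𝓝 (W * (v ⬝ᵥ m) / (r - 1))) := by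
  have hr0 : 0 < r := by linarith
  set A := r⁻¹ • M with hA
  set U : ℕ → n → ℝ := fun t => (r ^ t)⁻¹ • Z t with hUdef
  set ξ : ℕ → n → ℝ := fun t => (r ^ (t + 1))⁻¹ • η t with hξdef
  have hU : ∀ t, U (t + 1) = U t ᵥ* A + ξ t := fun t => by
    simp only [hUdef, hξdef, hA, hZ, smul_add, smul_vecMul, vecMul_smul, smul_smul, pow_succ,
      mul_inv]
    rw [mul_comm]
  have hξ : ∀ j, Summable fun t => |ξ t j| := fun j => by
    refine ((hη j).mul_left r⁻¹).congr fun t => ?_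
    simp only [hξdef, Pi.smul_apply, smul_eq_mul, abs_mul, abs_inv, abs_of_pos (pow_pos hr0 _)]
    rw [pow_succ]
    field_simp
  have hAh : A *ᵥ h = h := by
    rw [hA, smul_mulVec, hMh, smul_smul, inv_mul_cancel₀ hr0.ne', one_smul]
  have hvA : v ᵥ* A = v := by
    rw [hA, vecMul_smul, hvM, smul_smul, inv_mul_cancel₀ hr0.ne', one_smul]
  have hUZ : ∀ (u : n → ℝ) t, U t ⬝ᵥ u = Z t ⬝ᵥ u / r ^ t := fun u t => by
    simp only [hUdef, smul_dotProduct, smul_eq_mul]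
    rw [inv_mul_eq_div]
  -- As `A` fixes `h`, the pairing with `h` simply accumulates the noise.
  obtain ⟨W, hW⟩ : ∃ W, Tendsto (fun t => U t ⬝ᵥ h) atTop (𝓝 W) := by
    have hs : Summable fun t => ξ t ⬝ᵥ h :=
      summable_sum fun j _ => ((hξ j).of_abs).mul_right (h j)
    refine ⟨U 0 ⬝ᵥ h + ∑' t, ξ t ⬝ᵥ h, ?_⟩
    refine (hs.hasSum.tendsto_sum_nat.const_add (U 0 ⬝ᵥ h)).congr fun t => ?_
    induction t with
    | zero => simp
    | succ t ih =>
      rw [hU, add_dotProduct, ← dotProduct_mulVec, hAh, Finset.sum_range_succ, ← add_assoc, ih]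
  refine ⟨W, by simpa only [hUZ] using hW, ?_⟩
  have hm : Tendsto (fun t => U t ⬝ᵥ m) atTop (𝓝 (W * (v ⬝ᵥ m))) := by
    -- Split `m` into `(v ⬝ᵥ m) • h` and a remainder in the kernel of `v`, along which the powers of
    -- `A` decay.
    have h0 := tendsto_dotProduct_zero_of_recursion hU hξ
      ((hM.smul (inv_pos.2 hr0)).tendsto_pow_mulVec_zero hh hAh hvA hvh
        (w := m - (v ⬝ᵥ m) • h) (by simp [dotProduct_sub, dotProduct_smul, hvh]))
    have := h0.add (hW.mul_const (v ⬝ᵥ m))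
    rw [zero_add] at this
    refine this.congr fun t => ?_
    rw [dotProduct_sub, dotProduct_smul, smul_eq_mul]
    ring
  have := tendsto_of_linear_recursion (q := r⁻¹) (inv_nonneg.2 hr0.le) (inv_lt_one_of_one_lt₀ hr)
    (b := fun t => V t / r ^ t) (e := fun t => r⁻¹ * (U t ⬝ᵥ m + η' t / r ^ t))
    ((hm.add hη').const_mul r⁻¹) (fun t => by
      rw [hUZ, hV, pow_succ]
      field_simp
      ring)
  convert this using 2
  have : r - 1 ≠ 0 := by linarith
  field_simp
  simp

/-! ### Arc colours, node counts and their dependence on the choices -/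

/-- Finite lists of colours, with the discrete σ-algebra. -/
structure ColorList (C : Type) where
  /-- the length of the list -/
  length : ℕ
  /-- the entries of the list -/
  color : Fin length → C

namespace ColorList

instance {C : Type} : MeasurableSpace (ColorList C) := ⊤

instance {C : Type} : DiscreteMeasurableSpace (ColorList C) := ⟨fun _ => trivial⟩

/-- Countability lets one condition on the colours of `G^t` by summing over their values; the
coloured list is all that the law of the next round's arc and inner-node counts needs. -/
instance {C : Type} [Countable C] : Countable (ColorList C) :=
  Function.Injective.countable (f := fun c : ColorList C =>
    (⟨c.length, c.color⟩ : Σ n : ℕ, (Fin n → C))) fun c d h => by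
      cases c; cases d; cases h; rfl

variable {C : Type}

/-- The sum of a weight over a list of colours. -/
def sum (c : ColorList C) (u : C → ℝ) : ℝ := ∑ n, u (c.color n)

theorem sum_nonneg (c : ColorList C) {u : C → ℝ} (hu : ∀ i, 0 ≤ u i) : 0 ≤ c.sum u :=
  Finset.sum_nonneg fun _ _ => hu _

theorem sum_le_sum (c : ColorList C) {u u' : C → ℝ} (hu : ∀ i, u i ≤ u' i) :
    c.sum u ≤ c.sum u' :=
  Finset.sum_le_sum fun _ _ => hu _

theorem sum_smul (c : ColorList C) (a : ℝ) (u : C → ℝ) : c.sum (a • u) = a * c.sum u :=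
  (Finset.mul_sum _ _ _).symm

theorem sum_one (c : ColorList C) : c.sum (fun _ => 1) = c.length := by
  simp [sum]

theorem sum_eq_sum_single [Fintype C] [DecidableEq C] (c : ColorList C) (u : C → ℝ) :
    c.sum u = ∑ j, c.sum (Pi.single j 1) * u j := by
  simp only [sum, Finset.sum_mul]
  rw [Finset.sum_comm]
  refine Finset.sum_congr rfl fun n _ => ?_
  simp [Pi.single_apply]

end ColorList

namespace Network

variable {C : Type}

/-- The colours of the arcs of a network, in the order of the fixed numbering of its arcs. -/
def colorList (G : Network C) : ColorList C :=
  ⟨Nat.card G.E, fun n => G.color ((Finite.equivFin G.E).symm n)⟩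

theorem sum_equivFin (G : Network C) [Fintype G.E] (f : G.E → ℝ) :
    ∑ n, f ((Finite.equivFin G.E).symm n) = ∑ e, f e :=
  Equiv.sum_comp (Finite.equivFin G.E).symm f

theorem colorList_sum (G : Network C) [Fintype G.E] (u : C → ℝ) :
    G.colorList.sum u = ∑ e, u (G.color e) :=
  G.sum_equivFin fun e => u (G.color e)

theorem arcCount_eq_sum_single [DecidableEq C] (G : Network C) (j : C) :
    (G.arcCount j : ℝ) = G.colorList.sum (Pi.single j 1) := by
  classical
  have := Fintype.ofFinite G.E
  rw [colorList_sum, arcCount, Nat.card_eq_fintype_card, Fintype.card_subtype]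
  simp [Pi.single_apply]

theorem replaceArcs_colorList_sum (G : Network C) [Fintype G.E] (R : G.E → RuleNetwork C)
    (u : C → ℝ) :
    (G.replaceArcs R).colorList.sum u = ∑ e, (R e).colorList.sum u := by
  have : ∀ e, Fintype (R e).E := fun e => Fintype.ofFinite _
  let _ : Fintype (G.replaceArcs R).E := inferInstanceAs (Fintype (Σ e : G.E, (R e).E))
  rw [colorList_sum, Finset.sum_congr rfl fun e _ => (R e).colorList_sum u]
  exact Fintype.sum_sigma (fun a : Σ e : G.E, (R e).E => u ((R a.1).color a.2))

theorem card_replaceArcs_V (G : Network C) [Fintype G.E] (R : G.E → RuleNetwork C) :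
    (Nat.card (G.replaceArcs R).V : ℝ) =
      Nat.card G.V + ∑ e, (Nat.card (R e).Inner : ℝ) := by
  have : Nat.card (G.replaceArcs R).V = Nat.card (G.V ⊕ (Σ e : G.E, (R e).Inner)) := rfl
  rw [this, Nat.card_sum, Nat.card_sigma]
  push_cast
  rfl

end Network

namespace SubstitutionRules

variable {lam : ℕ} (S : SubstitutionRules lam)

/-- The sum over the arcs, with colours `c`, of a network at time `t`, of a quantity `g` that
depends on the rule chosen for the arc. -/
def choiceSum (t : ℕ) (c : ColorList (Fin lam)) (g : ∀ i, Fin (S.q i) → ℝ)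
    (x : ∀ a : ℕ × ℕ × Fin lam, Fin (S.q a.2.2)) : ℝ :=
  ∑ n : Fin c.length, g (c.color n) (x (t, n, c.color n))

/-- The expectation of a function of the rule chosen for an arc. -/
def mean (g : ∀ i, Fin (S.q i) → ℝ) (i : Fin lam) : ℝ := ∑ k, S.p i k * g i k

theorem mean_const (a : Fin lam → ℝ) : S.mean (fun i _ => a i) = a := by
  ext i
  rw [mean, ← Finset.sum_mul, S.p_sum, one_mul]

theorem mean_le_mean {g g' : ∀ i, Fin (S.q i) → ℝ} {i : Fin lam} (h : ∀ k, g i k ≤ g' i k) :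
    S.mean g i ≤ S.mean g' i :=
  Finset.sum_le_sum fun k _ => mul_le_mul_of_nonneg_left (h k) (S.p_pos i k).le

theorem mean_lt_mean {g g' : ∀ i, Fin (S.q i) → ℝ} {i : Fin lam} (h : ∀ k, g i k ≤ g' i k)
    (h' : ∃ k, g i k < g' i k) : S.mean g i < S.mean g' i := by
  obtain ⟨k, hk⟩ := h'
  exact Finset.sum_lt_sum (fun k _ => mul_le_mul_of_nonneg_left (h k) (S.p_pos i k).le)
    ⟨k, Finset.mem_univ k, mul_lt_mul_of_pos_left hk (S.p_pos i k)⟩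

theorem arcMatrix_mulVec (u : Fin lam → ℝ) :
    S.arcMatrix.mulVec u = S.mean fun i k => (S.R i k).colorList.sum u := by
  ext i
  simp only [Matrix.mulVec, dotProduct, arcMatrix, Matrix.of_apply, mean]
  simp only [ColorList.sum_eq_sum_single _ u, Network.arcCount_eq_sum_single, Finset.sum_mul,
    Finset.mul_sum, mul_assoc]
  rw [Finset.sum_comm]

variable (G₀ : Network (Fin lam)) (x x' : ∀ a : ℕ × ℕ × Fin lam, Fin (S.q a.2.2))

/-- One simultaneous replacement of all arcs at time `t`. -/
def substitute (t : ℕ) (G : Network (Fin lam)) : Network (Fin lam) :=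
  G.replaceArcs fun e => S.R (G.color e) (x (t, (Finite.equivFin G.E e : ℕ), G.color e))

theorem networkSeq_succ (t : ℕ) :
    S.networkSeq G₀ x (t + 1) = S.substitute x t (S.networkSeq G₀ x t) := rfl

theorem sum_networkSeq (t : ℕ) [Fintype (S.networkSeq G₀ x t).E] (g : ∀ i, Fin (S.q i) → ℝ) :
    ∑ e, g ((S.networkSeq G₀ x t).color e) (x (t,
      (Finite.equivFin (S.networkSeq G₀ x t).E e : ℕ), (S.networkSeq G₀ x t).color e)) =
    S.choiceSum t (S.networkSeq G₀ x t).colorList g x := by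
  rw [← Network.sum_equivFin]
  refine Finset.sum_congr rfl fun n _ => ?_
  rw [Equiv.apply_symm_apply]
  rfl

theorem networkSeq_succ_colorList_sum (t : ℕ) (u : Fin lam → ℝ) :
    (S.networkSeq G₀ x (t + 1)).colorList.sum u =
      S.choiceSum t (S.networkSeq G₀ x t).colorList (fun i k => (S.R i k).colorList.sum u) x := by
  have := Fintype.ofFinite (S.networkSeq G₀ x t).E
  rw [networkSeq, Network.replaceArcs_colorList_sum, ← sum_networkSeq]

theorem card_networkSeq_succ_V (t : ℕ) :
    (Nat.card (S.networkSeq G₀ x (t + 1)).V : ℝ) = Nat.card (S.networkSeq G₀ x t).V +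
      S.choiceSum t (S.networkSeq G₀ x t).colorList
        (fun i k => (Nat.card (S.R i k).Inner : ℝ)) x := by
  have := Fintype.ofFinite (S.networkSeq G₀ x t).E
  rw [networkSeq, Network.card_replaceArcs_V, ← sum_networkSeq]

theorem exists_arcs_le : ∃ K : ℕ, ∀ i k, (S.R i k).colorList.length ≤ K := by
  obtain ⟨K, hK⟩ := (Set.finite_range fun a : Σ i, Fin (S.q i) =>
    (S.R a.1 a.2).colorList.length).bddAbove
  exact ⟨K, fun i k => hK ⟨⟨i, k⟩, rfl⟩⟩

theorem exists_networkSeq_arcs_le (t : ℕ) :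
    ∃ B : ℕ, ∀ x, (S.networkSeq G₀ x t).colorList.length ≤ B := by
  obtain ⟨K, hK⟩ := S.exists_arcs_le
  induction t with
  | zero => exact ⟨G₀.colorList.length, fun x => le_rfl⟩
  | succ t ih =>
    obtain ⟨B, hB⟩ := ih
    refine ⟨B * K, fun x => ?_⟩
    rw [← Nat.cast_le (α := ℝ), ← ColorList.sum_one, networkSeq_succ_colorList_sum]
    calc _ ≤ ∑ _n : Fin (S.networkSeq G₀ x t).colorList.length, (K : ℝ) :=
          Finset.sum_le_sum fun n _ => by
            simp only [ColorList.sum_one]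
            exact_mod_cast hK _ _
      _ ≤ _ := by
          rw [Finset.sum_const, Finset.card_univ, Fintype.card_fin, nsmul_eq_mul]
          exact_mod_cast Nat.mul_le_mul_right K (hB x)

/-- `G^t` depends only on finitely many choices, all made before time `t`. -/
theorem exists_finset_networkSeq_congr (t : ℕ) : ∃ I : Finset (ℕ × ℕ × Fin lam),
    (∀ a ∈ I, a.1 < t) ∧ ∀ x x', (∀ a ∈ I, x a = x' a) →
      S.networkSeq G₀ x t = S.networkSeq G₀ x' t := by
  induction t with
  | zero => exact ⟨∅, by simp, fun _ _ _ => rfl⟩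
  | succ t ih =>
    obtain ⟨I, hI, h⟩ := ih
    obtain ⟨B, hB⟩ := S.exists_networkSeq_arcs_le G₀ t
    refine ⟨I ∪ {t} ×ˢ (Finset.range B ×ˢ Finset.univ), fun a ha => ?_, fun x x' hx => ?_⟩
    · rcases Finset.mem_union.1 ha with ha | ha
      · exact (hI a ha).trans (Nat.lt_succ_self t)
      · have := (Finset.mem_product.1 ha).1
        rw [Finset.mem_singleton] at this
        omega
    · have h1 := h x x' fun a ha => hx a (Finset.mem_union_left _ ha)
      have hB' := hB x'
      rw [networkSeq_succ, networkSeq_succ, h1, substitute, substitute]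
      congr 1
      funext e
      rw [hx _ (Finset.mem_union_right _ ?_)]
      simp only [Finset.mem_product, Finset.mem_singleton, Finset.mem_range, Finset.mem_univ,
        and_true, true_and]
      exact (Finite.equivFin _ e).2.trans_le hB'

/-- Factoring through finitely many finite-valued choices yields measurability, and the restriction
to times before `t` yields independence from the choices of round `t`. -/
theorem exists_finset_colorList_eq_comp [Nonempty (∀ a : ℕ × ℕ × Fin lam, Fin (S.q a.2.2))]
    (t : ℕ) : ∃ I : Finset (ℕ × ℕ × Fin lam), (∀ a ∈ I, a.1 < t) ∧
      ∃ ψ : (∀ a : I, Fin (S.q a.1.2.2)) → ColorList (Fin lam), ∀ x,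
        (S.networkSeq G₀ x t).colorList = ψ fun a => x a := by
  classical
  obtain ⟨I, hI, h⟩ := S.exists_finset_networkSeq_congr G₀ t
  refine ⟨I, hI, fun y => (S.networkSeq G₀ (fun a => if ha : a ∈ I then y ⟨a, ha⟩ else
    Classical.arbitrary (∀ a : ℕ × ℕ × Fin lam, Fin (S.q a.2.2)) a) t).colorList, fun x => ?_⟩
  congr 1
  refine h _ _ fun a ha => ?_
  simp [ha]

end SubstitutionRules

/-! ### Conditional moment and Laplace bounds for one round -/

/-- Bounding an integral by conditioning on a discrete random variable. -/
theorem lintegral_le_of_forall_indepFun {Ω σ : Type*} [MeasurableSpace Ω] {P : Measure Ω}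
    [Countable σ] [MeasurableSpace σ] [DiscreteMeasurableSpace σ] {Y : Ω → σ} (hY : Measurable Y)
    {F : σ → Ω → ENNReal} (hF : ∀ c, Measurable (F c)) (hind : ∀ c, IndepFun Y (F c) P)
    {H : σ → ENNReal} (hH : ∀ c, ∫⁻ ω, F c ω ∂P ≤ H c) :
    ∫⁻ ω, F (Y ω) ω ∂P ≤ ∫⁻ ω, H (Y ω) ∂P := by
  classical
  -- Indicators of `Y = c`: on that event `F (Y ω)` is `F c`, which is independent of the indicator.
  let φ : σ → σ → ENNReal := fun c d => if d = c then 1 else 0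
  have hφ : ∀ c, Measurable (φ c) := fun c => Measurable.of_discrete
  have hφY : ∀ c, Measurable fun ω => φ c (Y ω) := fun c => (hφ c).comp hY
  have expand : ∀ f : σ → Ω → ENNReal, (∀ c, Measurable (f c)) →
      ∫⁻ ω, f (Y ω) ω ∂P = ∑' c, ∫⁻ ω, φ c (Y ω) * f c ω ∂P := by
    intro f hf
    rw [← lintegral_tsum (f := fun c ω => φ c (Y ω) * f c ω)
      fun c => ((hφY c).mul (hf c)).aemeasurable]
    refine lintegral_congr fun ω => ?_
    rw [tsum_eq_single (Y ω)]
    · simp [φ]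
    · intro c hc
      simp [φ, hc.symm]
  rw [expand F hF, expand (fun c _ => H c) fun c => measurable_const]
  refine ENNReal.tsum_le_tsum fun c => ?_
  have h1 := lintegral_mul_eq_lintegral_mul_lintegral_of_indepFun'' (μ := P)
    (hφY c).aemeasurable (hF c).aemeasurable ((hind c).comp (hφ c) measurable_id)
  rw [h1, lintegral_mul_const _ (hφY c)]
  exact mul_le_mul_right (hH c) _

namespace SubstitutionRules.IsChoiceFamily

variable {lam : ℕ} {S : SubstitutionRules lam} {Ω : Type*} [MeasurableSpace Ω] {P : Measure Ω}
  {X : ∀ a : ℕ × ℕ × Fin lam, Ω → Fin (S.q a.2.2)}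

theorem measurable_apply (hX : S.IsChoiceFamily P X) {β : Type*} [MeasurableSpace β]
    (g : ∀ i, Fin (S.q i) → β) (a : ℕ × ℕ × Fin lam) : Measurable fun ω => g a.2.2 (X a ω) :=
  (Measurable.of_discrete (f := g a.2.2)).comp (hX.measurable a)

theorem iIndepFun_apply (hX : S.IsChoiceFamily P X) (g : ∀ i, Fin (S.q i) → ℝ) (t : ℕ)
    (c : ColorList (Fin lam)) :
    iIndepFun (fun (n : Fin c.length) ω => g (c.color n) (X (t, n, c.color n) ω)) P := by
  have hinj : Function.Injective fun n : Fin c.length => ((t, (n : ℕ), c.color n) :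
      ℕ × ℕ × Fin lam) := fun n m h => Fin.ext (Prod.ext_iff.1 (Prod.ext_iff.1 h).2).1
  exact (hX.indep.precomp hinj).comp (fun n => g (c.color n)) fun n => Measurable.of_discrete

theorem measurable_choiceSum (hX : S.IsChoiceFamily P X) (g : ∀ i, Fin (S.q i) → ℝ) (t : ℕ)
    (c : ColorList (Fin lam)) : Measurable fun ω => S.choiceSum t c g fun a => X a ω :=
  Finset.measurable_fun_sum _ fun n _ => hX.measurable_apply g (t, n, c.color n)

variable [IsProbabilityMeasure P]

theorem memLp_apply (hX : S.IsChoiceFamily P X) (g : ∀ i, Fin (S.q i) → ℝ)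
    (a : ℕ × ℕ × Fin lam) (p : ENNReal) : MemLp (fun ω => g a.2.2 (X a ω)) p P := by
  obtain ⟨C, hC⟩ := (Set.finite_range fun k => ‖g a.2.2 k‖).bddAbove
  exact MemLp.of_bound (hX.measurable_apply g a).aestronglyMeasurable C
    (Eventually.of_forall fun ω => hC ⟨_, rfl⟩)

theorem integral_apply (hX : S.IsChoiceFamily P X) (g : ∀ i, Fin (S.q i) → ℝ)
    (a : ℕ × ℕ × Fin lam) : ∫ ω, g a.2.2 (X a ω) ∂P = S.mean g a.2.2 := by
  have : IsProbabilityMeasure (P.map (X a)) :=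
    Measure.isProbabilityMeasure_map (hX.measurable a).aemeasurable
  rw [← integral_map (φ := X a) (f := g a.2.2) (hX.measurable a).aemeasurable
    (Measurable.of_discrete).aestronglyMeasurable, integral_fintype Integrable.of_finite, mean]
  refine Finset.sum_congr rfl fun k _ => ?_
  rw [measureReal_def, Measure.map_apply (hX.measurable a) (measurableSet_singleton k)]
  have := hX.law a k
  rw [show X a ⁻¹' {k} = {ω | X a ω = k} from rfl, this, ENNReal.toReal_ofReal (S.p_pos _ k).le,
    smul_eq_mul]

theorem memLp_choiceSum (hX : S.IsChoiceFamily P X) (g : ∀ i, Fin (S.q i) → ℝ) (t : ℕ)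
    (c : ColorList (Fin lam)) (p : ENNReal) :
    MemLp (fun ω => S.choiceSum t c g fun a => X a ω) p P :=
  memLp_finsetSum _ fun n _ => hX.memLp_apply g (t, n, c.color n) p

theorem integral_choiceSum (hX : S.IsChoiceFamily P X) (g : ∀ i, Fin (S.q i) → ℝ) (t : ℕ)
    (c : ColorList (Fin lam)) :
    ∫ ω, S.choiceSum t c g (fun a => X a ω) ∂P = c.sum (S.mean g) := by
  unfold choiceSum
  rw [integral_finsetSum _ fun (n : Fin c.length) _ =>
    (hX.memLp_apply g (t, n, c.color n) 1).integrable le_rfl]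
  exact Finset.sum_congr rfl fun n _ => hX.integral_apply g (t, n, c.color n)

theorem lintegral_choiceSum (hX : S.IsChoiceFamily P X) {g : ∀ i, Fin (S.q i) → ℝ}
    (hg : ∀ i k, 0 ≤ g i k) (t : ℕ) (c : ColorList (Fin lam)) :
    ∫⁻ ω, ENNReal.ofReal (S.choiceSum t c g fun a => X a ω) ∂P =
      ENNReal.ofReal (c.sum (S.mean g)) := by
  rw [← hX.integral_choiceSum g t c, ofReal_integral_eq_lintegral_ofReal
    ((hX.memLp_choiceSum g t c 1).integrable le_rfl)]
  exact Eventually.of_forall fun ω => Finset.sum_nonneg fun n _ => hg _ _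

/-- Variances of independent arcs add, and each is at most a second moment; the bound is therefore
linear in the arc counts. -/
theorem lintegral_choiceSum_sub_sq_le (hX : S.IsChoiceFamily P X) (g : ∀ i, Fin (S.q i) → ℝ)
    (t : ℕ) (c : ColorList (Fin lam)) :
    ∫⁻ ω, ENNReal.ofReal ((S.choiceSum t c g (fun a => X a ω) - c.sum (S.mean g)) ^ 2) ∂P ≤
      ENNReal.ofReal (c.sum (S.mean fun i k => g i k ^ 2)) := by
  rw [← hX.integral_choiceSum g t c, ← evariance_eq_lintegral_ofReal,
    ← ofReal_variance (hX.memLp_choiceSum g t c 2)]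
  refine ENNReal.ofReal_le_ofReal ?_
  have h1 : (fun ω => S.choiceSum t c g (fun a => X a ω)) =
      ∑ n : Fin c.length, fun ω => g (c.color n) (X (t, n, c.color n) ω) := by
    ext ω
    rw [Finset.sum_apply]
    rfl
  rw [h1, IndepFun.variance_sum (fun (n : Fin c.length) _ => hX.memLp_apply g (t, n, c.color n) 2)
    fun n _ m _ hnm => (hX.iIndepFun_apply g t c).indepFun hnm]
  refine Finset.sum_le_sum fun n _ => ?_
  refine (variance_le_expectation_sq
    (hX.measurable_apply g (t, n, c.color n)).aestronglyMeasurable).trans_eq ?_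
  exact hX.integral_apply (fun i k => g i k ^ 2) (t, n, c.color n)

/-- By independence the exponential of the sum factorises over the arcs. -/
theorem lintegral_exp_neg_choiceSum_le (hX : S.IsChoiceFamily P X) {g : ∀ i, Fin (S.q i) → ℝ}
    {u : Fin lam → ℝ} (hu : ∀ i, S.mean (fun i k => Real.exp (-g i k)) i ≤ Real.exp (-u i))
    (t : ℕ) (c : ColorList (Fin lam)) :
    ∫⁻ ω, ENNReal.ofReal (Real.exp (-S.choiceSum t c g fun a => X a ω)) ∂P ≤
      ENNReal.ofReal (Real.exp (-c.sum u)) := by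
  have hmeas : Measurable fun ω => Real.exp (-S.choiceSum t c g fun a => X a ω) :=
    (hX.measurable_choiceSum g t c).neg.exp
  have hexp : ∀ ω, Real.exp (-S.choiceSum t c g fun a => X a ω) =
      ∏ n : Fin c.length, Real.exp (-g (c.color n) (X (t, n, c.color n) ω)) := fun ω => by
    rw [choiceSum, ← Finset.sum_neg_distrib, Real.exp_sum]
  simp_rw [hexp, ENNReal.ofReal_prod_of_nonneg fun n _ => (Real.exp_pos _).le]
  have hind := (hX.iIndepFun_apply g t c).comp (fun _ y => ENNReal.ofReal (Real.exp (-y)))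
    fun _ => by fun_prop
  have := lintegral_prod_eq_prod_lintegral_of_indepFun Finset.univ _ hind fun n =>
    (hX.measurable_apply (fun i k => ENNReal.ofReal (Real.exp (-g i k))) (t, n, c.color n))
  simp only [Function.comp_apply] at this
  rw [this, ColorList.sum, ← Finset.sum_neg_distrib, Real.exp_sum,
    ENNReal.ofReal_prod_of_nonneg fun n _ => (Real.exp_pos _).le]
  refine Finset.prod_le_prod' fun n _ => ?_
  rw [← ofReal_integral_eq_lintegral_ofReal ((hX.memLp_apply (fun i k => Real.exp (-g i k))
    (t, n, c.color n) 1).integrable le_rfl) (Eventually.of_forall fun ω => (Real.exp_pos _).le),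
    hX.integral_apply (fun i k => Real.exp (-g i k)) (t, n, c.color n)]
  exact ENNReal.ofReal_le_ofReal (hu _)

variable (G₀ : Network (Fin lam))

theorem measurable_colorList (hX : S.IsChoiceFamily P X) (t : ℕ) :
    Measurable fun ω => (S.networkSeq G₀ (fun a => X a ω) t).colorList := by
  have : Nonempty Ω := nonempty_of_isProbabilityMeasure P
  have : Nonempty (∀ a : ℕ × ℕ × Fin lam, Fin (S.q a.2.2)) :=
    ⟨fun a => X a (Classical.arbitrary Ω)⟩
  obtain ⟨I, -, ψ, hψ⟩ := S.exists_finset_colorList_eq_comp G₀ t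
  simp_rw [hψ]
  exact (Measurable.of_discrete (f := ψ)).comp (measurable_pi_lambda _ fun a => hX.measurable a)

theorem indepFun_colorList_choiceSum (hX : S.IsChoiceFamily P X) (g : ∀ i, Fin (S.q i) → ℝ)
    (t : ℕ) (c : ColorList (Fin lam)) :
    IndepFun (fun ω => (S.networkSeq G₀ (fun a => X a ω) t).colorList)
      (fun ω => S.choiceSum t c g fun a => X a ω) P := by
  have : Nonempty Ω := nonempty_of_isProbabilityMeasure P
  have : Nonempty (∀ a : ℕ × ℕ × Fin lam, Fin (S.q a.2.2)) :=
    ⟨fun a => X a (Classical.arbitrary Ω)⟩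
  obtain ⟨I, hI, ψ, hψ⟩ := S.exists_finset_colorList_eq_comp G₀ t
  simp_rw [hψ]
  set J : Finset (ℕ × ℕ × Fin lam) :=
    Finset.univ.image fun n : Fin c.length => (t, (n : ℕ), c.color n) with hJ
  have hmem : ∀ n : Fin c.length, (t, (n : ℕ), c.color n) ∈ J := fun n =>
    Finset.mem_image_of_mem _ (Finset.mem_univ n)
  have hIJ : Disjoint I J := by
    rw [Finset.disjoint_left]
    intro a ha haJ
    obtain ⟨n, -, rfl⟩ := Finset.mem_image.1 haJ
    exact lt_irrefl _ (hI _ ha)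
  exact (hX.indep.indepFun_finset I J hIJ hX.measurable).comp (φ := ψ)
    (ψ := fun y : (∀ a : J, Fin (S.q a.1.2.2)) =>
      ∑ n : Fin c.length, g (c.color n) (y ⟨(t, n, c.color n), hmem n⟩))
    Measurable.of_discrete Measurable.of_discrete

theorem lintegral_le_of_forall_colorList (hX : S.IsChoiceFamily P X)
    (g : ∀ i, Fin (S.q i) → ℝ) (t : ℕ) {F : ColorList (Fin lam) → ℝ → ENNReal}
    (hF : ∀ c, Measurable (F c)) {H : ColorList (Fin lam) → ENNReal}
    (hH : ∀ c, ∫⁻ ω, F c (S.choiceSum t c g fun a => X a ω) ∂P ≤ H c) :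
    ∫⁻ ω, F (S.networkSeq G₀ (fun a => X a ω) t).colorList
        (S.choiceSum t (S.networkSeq G₀ (fun a => X a ω) t).colorList g fun a => X a ω) ∂P ≤
      ∫⁻ ω, H (S.networkSeq G₀ (fun a => X a ω) t).colorList ∂P :=
  lintegral_le_of_forall_indepFun (hX.measurable_colorList G₀ t)
    (F := fun c ω => F c (S.choiceSum t c g fun a => X a ω))
    (fun c => (hF c).comp (hX.measurable_choiceSum g t c))
    (fun c => (hX.indepFun_colorList_choiceSum G₀ g t c).comp measurable_id (hF c)) hH

end SubstitutionRules.IsChoiceFamily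

/-! ### Offspring of a single arc: growth and Laplace estimates -/

theorem Real.exp_neg_le_one_sub_add_sq {x : ℝ} (hx : 0 ≤ x) : Real.exp (-x) ≤ 1 - x + x ^ 2 := by
  -- Uses `1 + x ≤ exp x` and `(1 - x + x ^ 2) * (1 + x) = 1 + x ^ 3 ≥ 1`.
  rw [Real.exp_neg, inv_le_comm₀ (Real.exp_pos x) (by nlinarith)]
  refine le_trans ?_ (Real.add_one_le_exp x)
  rw [inv_le_iff_one_le_mul₀ (by nlinarith)]
  nlinarith [pow_nonneg hx 3]

namespace SubstitutionRules

variable {lam : ℕ} (S : SubstitutionRules lam)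

theorem exists_pos_mean_le_mul (g : ∀ i, Fin (S.q i) → ℝ) {h : Fin lam → ℝ} (hh : ∀ i, 0 < h i) :
    ∃ K : ℝ, 0 < K ∧ ∀ i, S.mean g i ≤ K * h i := by
  obtain ⟨δ, hδ, hle⟩ := exists_pos_mul_le (y := S.mean g) hh
  refine ⟨δ⁻¹, inv_pos.2 hδ, fun i => ?_⟩
  rw [inv_mul_eq_div, le_div_iff₀ hδ, mul_comm]
  exact hle i

/-- At a colour minimising `h`, the offspring weigh at least as much as their parent, and strictly
more with positive probability. -/
theorem one_lt_of_arcMatrix_mulVec_eq_smul [Nonempty (Fin lam)]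
    (hone : ∀ i k, 1 ≤ (S.R i k).colorList.length)
    (htwo : ∀ i, ∃ k, 1 < (S.R i k).colorList.length) {r : ℝ} {h : Fin lam → ℝ}
    (hh : ∀ i, 0 < h i) (hMh : S.arcMatrix.mulVec h = r • h) : 1 < r := by
  obtain ⟨i, hi⟩ := Finite.exists_min h
  have hle : ∀ k, (S.R i k).colorList.length * h i ≤ (S.R i k).colorList.sum h := fun k => by
    rw [← ColorList.sum_one, mul_comm, ← ColorList.sum_smul]
    exact ColorList.sum_le_sum _ fun j => by simpa using hi j
  have h1 := congrFun hMh i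
  rw [arcMatrix_mulVec, Pi.smul_apply, smul_eq_mul] at h1
  have h2 := S.mean_lt_mean (i := i) (g := fun i _ => h i)
    (g' := fun i k => (S.R i k).colorList.sum h)
    (fun k => le_trans (le_mul_of_one_le_left (hh i).le (by exact_mod_cast hone i k)) (hle k))
    (by
      obtain ⟨k, hk⟩ := htwo i
      exact ⟨k, lt_of_lt_of_le (lt_mul_of_one_lt_left (hh i) (by exact_mod_cast hk)) (hle k)⟩)
  rw [mean_const, h1] at h2
  nlinarith [hh i]

/-- Second-order expansion of the exponential: the first moment of the offspring weight is `r * h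
i`, and `C` controls its second moment. -/
theorem exists_laplace_bound {r : ℝ} {h : Fin lam → ℝ} (hh : ∀ i, 0 < h i)
    (hMh : S.arcMatrix.mulVec h = r • h) :
    ∃ C : ℝ, 0 < C ∧ ∀ θ : ℝ, 0 ≤ θ → ∀ i,
      S.mean (fun i k => Real.exp (-(S.R i k).colorList.sum (θ • h))) i ≤
        Real.exp (-((θ * (r - C * θ)) • h) i) := by
  set y : ∀ i, Fin (S.q i) → ℝ := fun i k => (S.R i k).colorList.sum h with hy
  obtain ⟨C, hC, hle⟩ := S.exists_pos_mean_le_mul (fun i k => y i k ^ 2) hh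
  refine ⟨C, hC, fun θ hθ i => ?_⟩
  have hy0 : ∀ k, 0 ≤ y i k := fun k => ColorList.sum_nonneg _ fun j => (hh j).le
  have hmean : S.mean y i = r * h i := by
    rw [hy, ← arcMatrix_mulVec, hMh]
    rfl
  calc _ ≤ S.mean (fun i k => 1 - θ * y i k + θ ^ 2 * y i k ^ 2) i := by
        refine S.mean_le_mean fun k => ?_
        rw [ColorList.sum_smul, ← mul_pow]
        exact Real.exp_neg_le_one_sub_add_sq (mul_nonneg hθ (hy0 k))
    _ = 1 - θ * S.mean y i + θ ^ 2 * S.mean (fun i k => y i k ^ 2) i := by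
        simp only [mean, Finset.mul_sum]
        nth_rw 2 [← S.p_sum i]
        rw [← Finset.sum_sub_distrib, ← Finset.sum_add_distrib]
        exact Finset.sum_congr rfl fun k _ => by ring
    _ ≤ -((θ * (r - C * θ)) * h i) + 1 := by
        rw [hmean]
        nlinarith [mul_le_mul_of_nonneg_left (hle i) (sq_nonneg θ)]
    _ ≤ _ := Real.add_one_le_exp _

theorem exists_laplace_bound_length
    (hone : ∀ i k, 1 ≤ (S.R i k).colorList.length)
    (htwo : ∀ i, ∃ k, 1 < (S.R i k).colorList.length) {c : ℝ} (hc : 0 < c) :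
    ∃ d : ℝ, 0 < d ∧ ∀ i, S.mean (fun i k => Real.exp (-(S.R i k).colorList.sum fun _ => c)) i ≤
      Real.exp (-(c + d)) := by
  have hsum : ∀ i k, (S.R i k).colorList.sum (fun _ => c) = c * (S.R i k).colorList.length :=
    fun i k => by simp [ColorList.sum, mul_comm]
  set f : Fin lam → ℝ := S.mean fun i k => Real.exp (-(S.R i k).colorList.sum fun _ => c)
  have hf : ∀ i, f i < Real.exp (-c) := fun i => by
    have := S.mean_lt_mean (i := i)
      (g := fun i k => Real.exp (-(S.R i k).colorList.sum fun _ => c))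
      (g' := fun _ _ => Real.exp (-c))
      (fun k => by
        rw [hsum, Real.exp_le_exp, neg_le_neg_iff]
        exact le_mul_of_one_le_right hc.le (by exact_mod_cast hone i k))
      (by
        obtain ⟨k, hk⟩ := htwo i
        refine ⟨k, ?_⟩
        rw [hsum, Real.exp_lt_exp, neg_lt_neg_iff]
        exact lt_mul_of_one_lt_right hc (by exact_mod_cast hk))
    rwa [mean_const] at this
  have hf0 : ∀ i, 0 < f i := fun i => by
    obtain ⟨k, -⟩ := htwo i
    exact Finset.sum_pos (fun k _ => mul_pos (S.p_pos i k) (Real.exp_pos _))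
      ⟨k, Finset.mem_univ k⟩
  obtain ⟨d, hd, hle⟩ := exists_pos_mul_le (x := fun i => -c - Real.log (f i)) (y := fun _ => 1)
    fun i => sub_pos.2 ((Real.log_lt_iff_lt_exp (hf0 i)).2 (hf i))
  refine ⟨d, hd, fun i => ?_⟩
  rw [← Real.log_le_iff_le_exp (hf0 i)]
  have := hle i
  linarith

theorem one_le_networkSeq_length (G₀ : Network (Fin lam)) (hG₀ : 1 ≤ G₀.colorList.length)
    (hone : ∀ i k, 1 ≤ (S.R i k).colorList.length)
    (x : ∀ a : ℕ × ℕ × Fin lam, Fin (S.q a.2.2)) (t : ℕ) :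
    1 ≤ (S.networkSeq G₀ x t).colorList.length := by
  induction t with
  | zero => exact hG₀
  | succ t ih =>
    refine ih.trans ?_
    rw [← Nat.cast_le (α := ℝ), ← ColorList.sum_one, ← ColorList.sum_one,
      networkSeq_succ_colorList_sum]
    refine Finset.sum_le_sum fun n _ => ?_
    simp only [ColorList.sum_one]
    exact_mod_cast hone _ _

/-! ### Almost sure summability of the noise and positivity of the limit -/

namespace IsChoiceFamily

variable {S} {Ω : Type*} [MeasurableSpace Ω] {P : Measure Ω} [IsProbabilityMeasure P]
  {X : ∀ a : ℕ × ℕ × Fin lam, Ω → Fin (S.q a.2.2)} (G₀ : Network (Fin lam))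

theorem measurable_networkSeq_sum (hX : S.IsChoiceFamily P X) (t : ℕ) (u : Fin lam → ℝ) :
    Measurable fun ω => (S.networkSeq G₀ (fun a => X a ω) t).colorList.sum u :=
  (Measurable.of_discrete (f := fun c : ColorList (Fin lam) => c.sum u)).comp
    (hX.measurable_colorList G₀ t)

theorem measurable_networkSeq_choiceSum (hX : S.IsChoiceFamily P X)
    (g : ∀ i, Fin (S.q i) → ℝ) (t : ℕ) :
    Measurable fun ω => S.choiceSum t (S.networkSeq G₀ (fun a => X a ω) t).colorList g
      fun a => X a ω :=
  (measurable_from_prod_countable_right (f := fun p : ColorList (Fin lam) × Ω =>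
    S.choiceSum t p.1 g fun a => X a p.2) fun c => hX.measurable_choiceSum g t c).comp
    ((hX.measurable_colorList G₀ t).prodMk measurable_id)

theorem lintegral_networkSeq_sum_le (hX : S.IsChoiceFamily P X) {r : ℝ} (hr : 0 ≤ r)
    {h : Fin lam → ℝ} (hh : ∀ i, 0 ≤ h i) (hMh : S.arcMatrix.mulVec h = r • h) (t : ℕ) :
    ∫⁻ ω, ENNReal.ofReal ((S.networkSeq G₀ (fun a => X a ω) t).colorList.sum h) ∂P ≤
      ENNReal.ofReal (r ^ t * G₀.colorList.sum h) := by
  induction t with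
  | zero => simp [networkSeq]
  | succ t ih =>
    simp_rw [networkSeq_succ_colorList_sum]
    refine (hX.lintegral_le_of_forall_colorList G₀ _ t (F := fun _ y => ENNReal.ofReal y)
      (fun _ => by fun_prop) (H := fun c => ENNReal.ofReal r * ENNReal.ofReal (c.sum h))
      fun c => ?_).trans ?_
    · rw [hX.lintegral_choiceSum fun i k => ColorList.sum_nonneg _ hh, ← arcMatrix_mulVec, hMh,
        ColorList.sum_smul, ENNReal.ofReal_mul hr]
    · rw [lintegral_const_mul _ (hX.measurable_networkSeq_sum G₀ t h).ennreal_ofReal, pow_succ',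
        mul_assoc, ENNReal.ofReal_mul hr]
      exact mul_le_mul_right ih _

theorem ae_summable_choiceSum_sub_mean (hX : S.IsChoiceFamily P X) {r : ℝ} (hr : 1 < r)
    {h : Fin lam → ℝ} (hh : ∀ i, 0 < h i) (hMh : S.arcMatrix.mulVec h = r • h)
    (g : ∀ i, Fin (S.q i) → ℝ) :
    ∀ᵐ ω ∂P, Summable fun t =>
      |S.choiceSum t (S.networkSeq G₀ (fun a => X a ω) t).colorList g (fun a => X a ω) -
        (S.networkSeq G₀ (fun a => X a ω) t).colorList.sum (S.mean g)| / r ^ t := by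
  obtain ⟨K, hK, hKle⟩ := S.exists_pos_mean_le_mul (fun i k => g i k ^ 2) hh
  set η : ℕ → Ω → ℝ := fun t ω =>
    S.choiceSum t (S.networkSeq G₀ (fun a => X a ω) t).colorList g (fun a => X a ω) -
      (S.networkSeq G₀ (fun a => X a ω) t).colorList.sum (S.mean g) with hη
  set L := K * G₀.colorList.sum h with hL
  have hL0 : 0 ≤ L := mul_nonneg hK.le (ColorList.sum_nonneg _ fun i => (hh i).le)
  have hηm : ∀ t, Measurable (η t) := fun t =>
    (hX.measurable_networkSeq_choiceSum G₀ g t).sub (hX.measurable_networkSeq_sum G₀ t _)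
  have hsecond : ∀ t, ∫⁻ ω, ENNReal.ofReal (η t ω ^ 2) ∂P ≤ ENNReal.ofReal (L * r ^ t) := by
    intro t
    refine (hX.lintegral_le_of_forall_colorList G₀ g t
      (F := fun c y => ENNReal.ofReal ((y - c.sum (S.mean g)) ^ 2))
      (fun _ => by fun_prop) (H := fun c => ENNReal.ofReal K * ENNReal.ofReal (c.sum h))
      fun c => ?_).trans ?_
    · refine (hX.lintegral_choiceSum_sub_sq_le g t c).trans ?_
      rw [← ENNReal.ofReal_mul hK.le, ← ColorList.sum_smul]
      exact ENNReal.ofReal_le_ofReal (ColorList.sum_le_sum _ hKle)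
    · rw [lintegral_const_mul _ (hX.measurable_networkSeq_sum G₀ t h).ennreal_ofReal, hL,
        mul_assoc, mul_comm _ (r ^ t), ENNReal.ofReal_mul hK.le]
      exact mul_le_mul_right (hX.lintegral_networkSeq_sum_le G₀ (by linarith)
        (fun i => (hh i).le) hMh t) _
  -- The weight `ρ ^ (3 * t)` lies between `r ^ t` and `r ^ (2 * t)`: the expected weighted squares
  -- are at most `L * ρ⁻¹ ^ t`, while `|η| * ρ ^ t ≤ η ^ 2 + ρ ^ (2 * t)` recovers the first powers
  -- at the cost of another geometric series.
  set ρ := √r with hρ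
  have hρ1 : 1 < ρ := Real.lt_sqrt_of_sq_lt (by simpa using hr)
  have hρ0 : 0 < ρ := by linarith
  have hρ2 : r = ρ ^ 2 := (Real.sq_sqrt (by linarith)).symm
  have hgeom : Summable fun t : ℕ => (ρ⁻¹) ^ t :=
    summable_geometric_of_lt_one (by positivity) (inv_lt_one_of_one_lt₀ hρ1)
  have hfin : ∫⁻ ω, ∑' t, ENNReal.ofReal (η t ω ^ 2 / ρ ^ (3 * t)) ∂P ≠ ⊤ := by
    rw [lintegral_tsum fun t => (((hηm t).pow_const 2).div_const _).ennreal_ofReal.aemeasurable]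
    refine ne_top_of_le_ne_top (hgeom.mul_left L).tsum_ofReal_ne_top
      (ENNReal.tsum_le_tsum fun t => ?_)
    have hpos : 0 < (ρ ^ (3 * t))⁻¹ := by positivity
    simp_rw [div_eq_inv_mul, ENNReal.ofReal_mul hpos.le]
    rw [lintegral_const_mul _ ((hηm t).pow_const 2).ennreal_ofReal]
    refine (mul_le_mul_right (hsecond t) _).trans_eq ?_
    rw [← ENNReal.ofReal_mul hpos.le]
    congr 1
    rw [hρ2, inv_pow]
    field_simp
    ring
  have hae := ae_lt_top (Measurable.tsum fun t =>
    (((hηm t).pow_const 2).div_const (ρ ^ (3 * t))).ennreal_ofReal) hfin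
  filter_upwards [hae] with ω hω
  have hs : Summable fun t => η t ω ^ 2 / ρ ^ (3 * t) := by
    refine (ENNReal.summable_toReal hω.ne).congr fun t => ?_
    rw [ENNReal.toReal_ofReal (by positivity)]
  refine Summable.of_nonneg_of_le (fun t => by positivity) (fun t => ?_) (hs.add hgeom)
  have h1 : η t ω ^ 2 / ρ ^ (3 * t) + ρ⁻¹ ^ t = (η t ω ^ 2 + (ρ ^ t) ^ 2) / ρ ^ (3 * t) := by
    rw [inv_pow]
    field_simp
    ring
  have h2 : |η t ω| / r ^ t = |η t ω| * ρ ^ t / ρ ^ (3 * t) := by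
    rw [hρ2]
    field_simp
    ring
  change |η t ω| / r ^ t ≤ _
  rw [h1, h2, ← sq_abs (η t ω)]
  gcongr
  nlinarith [sq_nonneg (|η t ω| - ρ ^ t), sq_nonneg (|η t ω|), sq_nonneg (ρ ^ t)]

theorem lintegral_exp_neg_networkSeq_succ_le (hX : S.IsChoiceFamily P X) {u u' : Fin lam → ℝ}
    (hu : ∀ i, S.mean (fun i k => Real.exp (-(S.R i k).colorList.sum u)) i ≤ Real.exp (-u' i))
    (t : ℕ) :
    ∫⁻ ω, ENNReal.ofReal
        (Real.exp (-(S.networkSeq G₀ (fun a => X a ω) (t + 1)).colorList.sum u)) ∂P ≤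
      ∫⁻ ω, ENNReal.ofReal
        (Real.exp (-(S.networkSeq G₀ (fun a => X a ω) t).colorList.sum u')) ∂P := by
  simp_rw [networkSeq_succ_colorList_sum]
  exact hX.lintegral_le_of_forall_colorList G₀ _ t
    (F := fun _ y => ENNReal.ofReal (Real.exp (-y)))
    (fun _ => by fun_prop) (H := fun c => ENNReal.ofReal (Real.exp (-c.sum u')))
    fun c => hX.lintegral_exp_neg_choiceSum_le hu t c

/-- Going back one round raises the weight of each arc from `c` to `c + d`; since at least one arc
is always present, every round gains a factor `exp (-d)`. -/
theorem tendsto_lintegral_exp_neg_length (hX : S.IsChoiceFamily P X)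
    (hG₀ : 1 ≤ G₀.colorList.length) (hone : ∀ i k, 1 ≤ (S.R i k).colorList.length)
    (htwo : ∀ i, ∃ k, 1 < (S.R i k).colorList.length) {c : ℝ} (hc : 0 < c) :
    Tendsto (fun t => ∫⁻ ω, ENNReal.ofReal
      (Real.exp (-(S.networkSeq G₀ (fun a => X a ω) t).colorList.sum fun _ => c)) ∂P)
      atTop (𝓝 0) := by
  obtain ⟨d, hd, hle⟩ := S.exists_laplace_bound_length hone htwo hc
  set e := ENNReal.ofReal (Real.exp (-d)) with he
  have he1 : e < 1 := by
    rw [he, ← ENNReal.ofReal_one]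
    exact (ENNReal.ofReal_lt_ofReal_iff one_pos).2 (Real.exp_lt_one_iff.2 (by linarith))
  refine tendsto_of_tendsto_of_tendsto_of_le_of_le tendsto_const_nhds
    (ENNReal.tendsto_pow_atTop_nhds_zero_of_lt_one he1) (fun _ => zero_le) fun t => ?_
  induction t with
  | zero =>
    refine (lintegral_mono fun ω => ?_).trans_eq (lintegral_const (μ := P) 1) |>.trans (by simp)
    rw [ENNReal.ofReal_le_one]
    exact Real.exp_le_one_iff.2 (neg_nonpos.2 (ColorList.sum_nonneg _ fun _ => hc.le))
  | succ t ih =>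
    refine (hX.lintegral_exp_neg_networkSeq_succ_le G₀ hle t).trans ?_
    rw [pow_succ']
    refine le_trans ?_ (mul_le_mul_right ih e)
    have hm : Measurable fun ω => ENNReal.ofReal (Real.exp
        (-(S.networkSeq G₀ (fun a => X a ω) t).colorList.sum fun _ => c)) :=
      (hX.measurable_networkSeq_sum G₀ t _).neg.exp.ennreal_ofReal
    rw [← lintegral_const_mul _ hm]
    refine lintegral_mono fun ω => ?_
    rw [he, ← ENNReal.ofReal_mul (Real.exp_pos _).le, ← Real.exp_add]
    refine ENNReal.ofReal_le_ofReal (Real.exp_le_exp.2 ?_)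
    have h1 := S.one_le_networkSeq_length G₀ hG₀ hone (fun a => X a ω) t
    have h2 : (1 : ℝ) ≤ (S.networkSeq G₀ (fun a => X a ω) t).colorList.length := by
      exact_mod_cast h1
    simp only [ColorList.sum, Finset.sum_const, Finset.card_univ, Fintype.card_fin, nsmul_eq_mul]
    nlinarith

theorem exists_lintegral_exp_neg_div_pow_le (hX : S.IsChoiceFamily P X) {r : ℝ} (hr : 1 < r)
    {h : Fin lam → ℝ} (hh : ∀ i, 0 < h i) (hMh : S.arcMatrix.mulVec h = r • h) :
    ∃ a : ℝ, 0 < a ∧ ∀ s n : ℕ,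
      ∫⁻ ω, ENNReal.ofReal (Real.exp
        (-(S.networkSeq G₀ (fun a => X a ω) (s + n)).colorList.sum ((2 * a / r ^ n) • h))) ∂P ≤
      ∫⁻ ω, ENNReal.ofReal (Real.exp
        (-(S.networkSeq G₀ (fun a => X a ω) s).colorList.sum (a • h))) ∂P := by
  obtain ⟨C, hC, hle⟩ := S.exists_laplace_bound hh hMh
  have hr0 : 0 < r := by linarith
  set b := (r ^ 2 - r) / (2 * C) with hb
  have hb0 : 0 < b := div_pos (by nlinarith) (by linarith)
  have hbC : 2 * C * b = r ^ 2 - r := by rw [hb]; field_simp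
  -- An explicit subsolution of the backward iteration `θ ↦ θ * (r - C * θ)`. The correction `1 -
  -- r⁻¹ ^ n / 2` absorbs the quadratic loss, and `b` is chosen so that `2 * C * b = r ^ 2 - r`. It
  -- starts at `β 0 = b / 2`, whence `a`, and stays below `2 * a / r ^ n`.
  let β : ℕ → ℝ := fun n => b * r⁻¹ ^ n * (1 - r⁻¹ ^ n / 2)
  have hz1 : ∀ n, r⁻¹ ^ n ≤ 1 := fun n =>
    pow_le_one₀ (by positivity) (inv_le_one_of_one_le₀ hr.le)
  have hz0 : ∀ n, 0 < r⁻¹ ^ n := fun n => by positivity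
  have hβ0 : ∀ n, 0 ≤ β n := fun n =>
    mul_nonneg (by positivity) (by linarith [hz1 n])
  have hβ : ∀ n, β n ≤ β (n + 1) * (r - C * β (n + 1)) := fun n => by
    obtain ⟨z, hz⟩ : ∃ z, z = r⁻¹ ^ (n + 1) := ⟨_, rfl⟩
    have hzn : r⁻¹ ^ n = r * z := by rw [hz, pow_succ]; field_simp
    have hz0' : 0 < z := hz ▸ hz0 (n + 1)
    have hz1' : z ≤ 1 := hz ▸ hz1 (n + 1)
    simp only [β, hzn, ← hz]
    have hkey : b * z * (1 - z / 2) * (r - C * (b * z * (1 - z / 2))) -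
        b * (r * z) * (1 - r * z / 2) =
        b * z ^ 2 / 2 * ((r ^ 2 - r) - 2 * C * b * (1 - z / 2) ^ 2) := by ring
    have : 0 ≤ (r ^ 2 - r) - 2 * C * b * (1 - z / 2) ^ 2 := by
      rw [hbC]
      have h1 : (1 - z / 2) ^ 2 ≤ 1 := pow_le_one₀ (by linarith) (by linarith)
      have h2 : 0 ≤ r ^ 2 - r := by nlinarith
      nlinarith
    have := mul_nonneg (show 0 ≤ b * z ^ 2 / 2 by positivity) this
    linarith
  have hmono : ∀ (t : ℕ) {θ θ' : ℝ}, θ' ≤ θ → ∫⁻ ω, ENNReal.ofReal (Real.exp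
        (-(S.networkSeq G₀ (fun a => X a ω) t).colorList.sum (θ • h))) ∂P ≤
      ∫⁻ ω, ENNReal.ofReal (Real.exp
        (-(S.networkSeq G₀ (fun a => X a ω) t).colorList.sum (θ' • h))) ∂P := by
    intro t θ θ' hθ
    refine lintegral_mono fun ω => ENNReal.ofReal_le_ofReal (Real.exp_le_exp.2
      (neg_le_neg (ColorList.sum_le_sum _ fun i => ?_)))
    exact mul_le_mul_of_nonneg_right hθ (hh i).le
  refine ⟨b / 2, by positivity, fun s n => ?_⟩
  have hstep : ∫⁻ ω, ENNReal.ofReal (Real.exp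
        (-(S.networkSeq G₀ (fun a => X a ω) (s + n)).colorList.sum (β n • h))) ∂P ≤
      ∫⁻ ω, ENNReal.ofReal (Real.exp
        (-(S.networkSeq G₀ (fun a => X a ω) s).colorList.sum ((b / 2) • h))) ∂P := by
    induction n with
    | zero =>
      refine hmono s (le_of_eq ?_)
      simp only [β]
      ring
    | succ n ih =>
      exact ((hX.lintegral_exp_neg_networkSeq_succ_le G₀ (hle _ (hβ0 (n + 1))) (s + n)).trans
        (hmono _ (hβ n))).trans ih
  refine (hmono _ ?_).trans hstep
  simp only [β]
  rw [show 2 * (b / 2) / r ^ n = b * r⁻¹ ^ n by rw [inv_pow]; ring]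
  exact mul_le_of_le_one_right (by positivity) (by linarith [hz0 n])

theorem ae_not_tendsto_zero (hX : S.IsChoiceFamily P X)
    (hG₀ : 1 ≤ G₀.colorList.length) (hone : ∀ i k, 1 ≤ (S.R i k).colorList.length)
    (htwo : ∀ i, ∃ k, 1 < (S.R i k).colorList.length) {r : ℝ} (hr : 1 < r)
    {h : Fin lam → ℝ} (hh : ∀ i, 0 < h i) (hMh : S.arcMatrix.mulVec h = r • h) :
    ∀ᵐ ω ∂P, ¬ Tendsto (fun t => (S.networkSeq G₀ (fun a => X a ω) t).colorList.sum h / r ^ t)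
      atTop (𝓝 0) := by
  obtain ⟨a, ha, hle⟩ := hX.exists_lintegral_exp_neg_div_pow_le G₀ hr hh hMh
  have hr0 : 0 < r := by linarith
  obtain ⟨c, hc, hch⟩ := exists_pos_mul_le (x := a • h) (y := fun _ => 1)
    fun i => mul_pos ha (hh i)
  set bad : Set Ω := {ω | Tendsto
    (fun t => (S.networkSeq G₀ (fun a => X a ω) t).colorList.sum h / r ^ t) atTop (𝓝 0)}
    with hbad
  -- On `bad` the exponents at time `s + n` tend to `0`, so the integrands tend to `1`; Fatou's
  -- lemma carries the bound, uniform in `n`, over to `P bad`.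
  have hbound : ∀ s, P bad ≤ ∫⁻ ω, ENNReal.ofReal
      (Real.exp (-(S.networkSeq G₀ (fun a => X a ω) s).colorList.sum fun _ => c)) ∂P := by
    intro s
    let f : ℕ → Ω → ENNReal := fun n ω => ENNReal.ofReal (Real.exp
      (-(S.networkSeq G₀ (fun a => X a ω) (s + n)).colorList.sum ((2 * a / r ^ n) • h)))
    have hfm : ∀ n, Measurable (f n) := fun n =>
      (hX.measurable_networkSeq_sum G₀ (s + n) _).neg.exp.ennreal_ofReal
    have hlim : ∀ ω ∈ bad, 1 ≤ liminf (fun n => f n ω) atTop := by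
      intro ω hω
      have h1 : Tendsto (fun n => -(2 * a * r ^ s *
          ((S.networkSeq G₀ (fun a => X a ω) (n + s)).colorList.sum h / r ^ (n + s))))
          atTop (𝓝 0) := by
        simpa using (((tendsto_add_atTop_iff_nat s).2 hω).const_mul (2 * a * r ^ s)).neg
      have h2 := ENNReal.tendsto_ofReal ((Real.continuous_exp.tendsto 0).comp h1)
      rw [Real.exp_zero, ENNReal.ofReal_one] at h2
      refine (h2.congr fun n => ?_).liminf_eq.ge
      simp only [f, Function.comp_apply]
      rw [ColorList.sum_smul, add_comm s n]
      congr 3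
      rw [pow_add]
      field_simp
    calc P bad ≤ P {ω | 1 ≤ liminf (fun n => f n ω) atTop} := measure_mono hlim
      _ ≤ ∫⁻ ω, liminf (fun n => f n ω) atTop ∂P := by
          simpa using mul_meas_ge_le_lintegral (μ := P) (.liminf hfm) 1
      _ ≤ liminf (fun n => ∫⁻ ω, f n ω ∂P) atTop := lintegral_liminf_le hfm
      _ ≤ liminf (fun _ : ℕ => ∫⁻ ω, ENNReal.ofReal (Real.exp
            (-(S.networkSeq G₀ (fun a => X a ω) s).colorList.sum (a • h))) ∂P) atTop :=
          liminf_le_liminf (Eventually.of_forall fun n => hle s n)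
      _ = ∫⁻ ω, ENNReal.ofReal (Real.exp
            (-(S.networkSeq G₀ (fun a => X a ω) s).colorList.sum (a • h))) ∂P :=
          liminf_const _
      _ ≤ _ := lintegral_mono fun ω => ENNReal.ofReal_le_ofReal (Real.exp_le_exp.2
          (neg_le_neg (ColorList.sum_le_sum _ fun i => by simpa using hch i)))
  have h0 : P bad = 0 := le_antisymm (ge_of_tendsto'
    (hX.tendsto_lintegral_exp_neg_length G₀ hG₀ hone htwo hc) hbound) zero_le
  exact measure_eq_zero_iff_ae_notMem.1 h0

end IsChoiceFamily

end SubstitutionRules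

/-! ### Consequences of the graph hypotheses, and the theorem -/

theorem Network.inDeg_add_outDeg_le_one {C : Type} (G : Network C) [Subsingleton G.E]
    (hG : ∀ e, G.src e ≠ G.tgt e) (v : G.V) : G.inDeg v + G.outDeg v ≤ 1 := by
  have hin : G.inDeg v ≤ 1 := Finite.card_le_one_iff_subsingleton.2 inferInstance
  have hout : G.outDeg v ≤ 1 := Finite.card_le_one_iff_subsingleton.2 inferInstance
  by_contra hlt
  have h1 : 0 < G.inDeg v := by omega
  have h2 : 0 < G.outDeg v := by omega
  obtain ⟨⟨⟨e, he⟩⟩, -⟩ := Nat.card_pos_iff.1 h1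
  obtain ⟨⟨⟨f, hf⟩⟩, -⟩ := Nat.card_pos_iff.1 h2
  rw [Subsingleton.elim f e] at hf
  exact hG e (hf.trans he.symm)

/-- Without inner nodes, an arc between different nodes would join `A` and `B`, putting them at
distance `1`. -/
theorem RuleNetwork.nonempty_inner {C : Type} (R : RuleNetwork C)
    (hdist : 1 < R.underlying.edist R.A R.B) (harc : ∃ e : R.E, R.src e ≠ R.tgt e) :
    Nonempty R.Inner := by
  obtain ⟨e, he⟩ := harc
  by_contra hne
  have hAB : ∀ v, v = R.A ∨ v = R.B := fun v => by
    by_contra hv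
    exact hne ⟨⟨v, not_or.1 hv⟩⟩
  have hadj : R.underlying.Adj R.A R.B := by
    rw [Network.underlying, SimpleGraph.fromRel_adj]
    refine ⟨R.A_ne_B, ?_⟩
    rcases hAB (R.src e) with h1 | h1 <;> rcases hAB (R.tgt e) with h2 | h2
    · exact absurd (h1.trans h2.symm) he
    · exact Or.inl ⟨e, h1, h2⟩
    · exact Or.inr ⟨e, h1, h2⟩
    · exact absurd (h1.trans h2.symm) he
  exact absurd (SimpleGraph.edist_eq_one_iff_adj.2 hadj) hdist.ne'

/-- A lone arc that is not a loop contributes at most `1` to the total degree of any node. -/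
theorem RuleNetwork.one_lt_length {C : Type} (R : RuleNetwork C)
    (hdeg : 1 < R.inDeg R.A + R.outDeg R.A ∨ 1 < R.inDeg R.B + R.outDeg R.B)
    (harc : ∃ e : R.E, R.src e ≠ R.tgt e) : 1 < R.colorList.length := by
  by_contra hlt
  have : Subsingleton R.E := Finite.card_le_one_iff_subsingleton.1 (not_lt.1 hlt)
  obtain ⟨e, he⟩ := harc
  have hall : ∀ f, R.src f ≠ R.tgt f := fun f => Subsingleton.elim e f ▸ he
  have hA := R.inDeg_add_outDeg_le_one hall R.A
  have hB := R.inDeg_add_outDeg_le_one hall R.B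
  omega

theorem mainTheorem5 {lam : ℕ} (S : SubstitutionRules lam) (G₀ : Network (Fin lam))
    (hG₀ : Nonempty G₀.E)
    (hprim : S.arcMatrix.IsPrimitive)
    (hdist : ∀ i, ∃ k, 1 < (S.R i k).underlying.edist (S.R i k).A (S.R i k).B)
    (hdeg : ∀ i, ∃ k,
      1 < (S.R i k).inDeg (S.R i k).A + (S.R i k).outDeg (S.R i k).A ∨
      1 < (S.R i k).inDeg (S.R i k).B + (S.R i k).outDeg (S.R i k).B)
    (harc : ∀ i k, ∃ e : (S.R i k).E, (S.R i k).src e ≠ (S.R i k).tgt e)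
    {Ω : Type*} [MeasurableSpace Ω] (P : Measure Ω) [IsProbabilityMeasure P]
    (X : ∀ a : ℕ × ℕ × Fin lam, Ω → Fin (S.q a.2.2)) (hX : S.IsChoiceFamily P X) :
    ∀ᵐ ω ∂P, AsympProp
      (fun t => (Nat.card (S.networkSeq G₀ (fun a => X a ω) t).V : ℝ))
      (fun t => realSpectralRadius S.arcMatrix ^ t) := by
  have hcol : Nonempty (Fin lam) := hG₀.map G₀.color
  have : NeZero lam := ⟨(Fin.pos hcol.some).ne'⟩
  have hlen₀ : 1 ≤ G₀.colorList.length := Nat.card_pos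
  have hone : ∀ i k, 1 ≤ (S.R i k).colorList.length := fun i k => by
    have : Nonempty (S.R i k).E := ⟨(harc i k).choose⟩
    exact Nat.card_pos
  have htwo : ∀ i, ∃ k, 1 < (S.R i k).colorList.length := fun i =>
    (hdeg i).imp fun k hk => (S.R i k).one_lt_length hk (harc i k)
  obtain ⟨r, hr0, h, v, hh, hv, hMh, hvM, hvh⟩ := hprim.exists_left_right_eigenvector
  have hr := S.one_lt_of_arcMatrix_mulVec_eq_smul hone htwo hh hMh
  rw [realSpectralRadius_eq_of_pos_eigenvector hprim.nonneg hh hr0.le hMh]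
  set inner : ∀ i, Fin (S.q i) → ℝ := fun i k => (Nat.card (S.R i k).Inner : ℝ) with hinner
  have hpos : ∀ i, 0 < S.mean inner i := fun i => by
    have := S.mean_lt_mean (i := i) (g := fun _ _ => 0) (g' := inner)
      (fun k => Nat.cast_nonneg _) (by
        obtain ⟨k, hk⟩ := hdist i
        have := (S.R i k).nonempty_inner hk (harc i k)
        exact ⟨k, Nat.cast_pos.2 Nat.card_pos⟩)
    rwa [S.mean_const] at this
  -- Weighting by `Pi.single j 1` counts the `j`-coloured arcs, so this is the noise of the vector
  -- recursion, one coordinate at a time.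
  have hnoise := ae_all_iff.2 fun j => hX.ae_summable_choiceSum_sub_mean G₀ hr hh hMh
    fun i k => (S.R i k).colorList.sum (Pi.single j 1)
  filter_upwards [hnoise, hX.ae_summable_choiceSum_sub_mean G₀ hr hh hMh inner,
    hX.ae_not_tendsto_zero G₀ hlen₀ hone htwo hr hh hMh] with ω hη hη' hne
  set x : ∀ a : ℕ × ℕ × Fin lam, Fin (S.q a.2.2) := fun a => X a ω
  set Z : ℕ → Fin lam → ℝ := fun t j =>
    (S.networkSeq G₀ x t).colorList.sum (Pi.single j 1) with hZ
  have hZsum : ∀ t u, (S.networkSeq G₀ x t).colorList.sum u = Z t ⬝ᵥ u := fun t u =>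
    ColorList.sum_eq_sum_single _ u
  obtain ⟨W, hW, hV⟩ := tendsto_div_pow_of_recursion hprim hr hh hMh hvM hvh (Z := Z)
    (η := fun t j => S.choiceSum t (S.networkSeq G₀ x t).colorList
        (fun i k => (S.R i k).colorList.sum (Pi.single j 1)) x -
      (S.networkSeq G₀ x t).colorList.sum
        (S.mean fun i k => (S.R i k).colorList.sum (Pi.single j 1)))
    (fun t => by
      ext j
      have h1 : Matrix.vecMul (Z t) S.arcMatrix j = (S.networkSeq G₀ x t).colorList.sum
          (S.mean fun i k => (S.R i k).colorList.sum (Pi.single j 1)) := by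
        rw [← SubstitutionRules.arcMatrix_mulVec, hZsum, Matrix.mulVec_single_one]
        rfl
      rw [Pi.add_apply, h1, add_sub_cancel, ← SubstitutionRules.networkSeq_succ_colorList_sum])
    hη (m := S.mean inner) (V := fun t => (Nat.card (S.networkSeq G₀ x t).V : ℝ))
    (η' := fun t => S.choiceSum t (S.networkSeq G₀ x t).colorList inner x -
      (S.networkSeq G₀ x t).colorList.sum (S.mean inner))
    (fun t => by
      rw [S.card_networkSeq_succ_V, ← hZsum]
      ring)
    (by
      rw [tendsto_zero_iff_abs_tendsto_zero]
      refine hη'.tendsto_atTop_zero.congr fun t => ?_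
      simp only [Function.comp_apply, abs_div, abs_of_pos (pow_pos hr0 t)])
  refine ⟨_, ?_, hV⟩
  have hW0 : 0 ≤ W := ge_of_tendsto' hW fun t => by
    rw [← hZsum]
    exact div_nonneg (ColorList.sum_nonneg _ fun i => (hh i).le) (pow_pos hr0 t).le
  have hWpos : 0 < W := hW0.lt_of_ne fun h0 => hne (by
    rw [h0]
    simpa only [hZsum] using hW)
  have hvm : 0 < v ⬝ᵥ S.mean inner :=
    Finset.sum_pos (fun i _ => mul_pos (hv i) (hpos i)) Finset.univ_nonempty
  exact div_pos (mul_pos hWpos hvm) (by linarith)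

end
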